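/- **Setting.** An input consists of a finite simple graph on $\{1,\dots,n\}$ given by adjacency lists, node features $x_i\in\mathbb R^{d_0}$, edge features $e_{iu}\in\mathbb R^{d_e}$, a node $v$ and a parameter vector $\theta$. A one-layer message passing network ($L=1$) computes $$h_v=\sum_{u\in\mathcal N(v)}M_{vu}(x_v,x_u,e_{vu},\theta),\qquad z_v=U(x_v,h_v,\theta),$$ where $M_{vu}$ may depend on the nodes $v,u$ and their degrees. (If the model includes the centre node in its own neighbourhood, $\mathcal N(v)$ is replaced by $\mathcal N(v)\cup\{v\}$, and $\deg(v)=|\mathcal N(v)|$ accordingly.) One-layer GraphSAGE-GCN with activation $\sigma:\mathbb R\to\mathbb R$ is the model with the centre node included, $\theta=W\in\mathbb R^{d_1\times d_0}$, $M_{vu}=x_u/\deg(v)$ and $U=\sigma(Wh_v)$, $\sigma$ being applied coordinatewise. An algorithm knows $n$, $v$, $\theta$ and the model, and accesses the rest of the input only through adaptive queries for the degree of a node, the $i$-th neighbour of a node (with the feature of the connecting edge), and the feature of a node; it may be randomized, and its complexity is the number of queries. It *$(\varepsilon,\delta)$-approximates* the model under the bound $B$ if $\Pr[\|\hat z_v-z_v\|_2\ge\varepsilon]\le\delta$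 for every input with $\|x_i\|_2\le B$ for all nodes $i$, $\|e_{iu}\|_2\le B$ for all $i$ and all $u\in\mathcal N(i)$, and $\|\theta\|_2\le B$. *Neighbor sampling* with $r$ samples draws a multiset $S$ of $r$ neighbours of $v$ uniformly with replacement and returns $U\bigl(x_v,\frac{\deg(v)}{r}\sum_{u\in S}M_{vu}(x_v,x_u,e_{vu},\theta),\theta\bigr)$. **Theorem.** For one-layer models the $O(\varepsilon^{-2}\log(1/\delta))$ query complexity of neighbor sampling is optimal in $\varepsilon$; that is: 1. Consider a one-layer model such that, on every bounded domain, $U$ and all the functions $\deg(i)M_{iu}$ are Lipschitz with a common constant independent of the graph and the nodes, and such that the functions $\deg(i)M_{iu}$ are bounded at the origin uniformly in the graph and the nodes. For every $B$ there is a constant $C>0$ such that for all $0<\varepsilon\le1$ and $0<\delta\le\frac12$ there is a sample size $r\geq 1$, independent of the input, for which neighbor sampling with $r$ samples $(\varepsilon,\delta)$-approximates the model under the bound $B$ and always makes at most $C\,\varepsilon^{-2}\log(1/\delta)$ queries. 2. Let $d_0,d_1\ge1$ and let $\sigma$ be a non-constant Lipschitz activation. Then one-layer GraphSAGE-GCN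 with activation $\sigma$ satisfies the hypothesis of part 1, and there is $B_0$ such that for all $B\ge B_0$ and $0<\delta<1$ there are $c,\varepsilon_0>0$ with the following property: for every $0<\varepsilon<\varepsilon_0$, every randomized algorithm that $(\varepsilon,\delta)$-approximates the model under the bound $B$ makes at least $c\,\varepsilon^{-2}$ queries in expectation on some input satisfying the bound $B$. In particular no algorithm approximates it with $o(\varepsilon^{-2})$ queries. -/

import Mathlib

open MeasureTheory
open scoped NNReal ENNReal

/-- Euclidean space `ℝ^d` with the 2-norm. -/
abbrev Vec (d : ℕ) : Type := EuclideanSpace ℝ (Fin d)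

/-- An input with nodes `Fin n`: a simple graph given by adjacency lists (in an arbitrary order),
node features and edge features. If `loops = true`, the neighbourhood of a node `v` is
`𝒩(v) ∪ {v}`; otherwise it is `𝒩(v)`. -/
structure GraphInput (loops : Bool) (n d₀ dₑ : ℕ) where
  graph : SimpleGraph (Fin n)
  nbrs : Fin n → List (Fin n)
  nodup_nbrs : ∀ v, (nbrs v).Nodup
  mem_nbrs : ∀ v u, u ∈ nbrs v ↔ graph.Adj v u ∨ (loops = true ∧ u = v)
  feature : Fin n → Vec d₀
  edge : Fin n → Fin n → Vec dₑ

namespace GraphInput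

variable {loops : Bool} {n d₀ dₑ : ℕ}

/-- The degree of `v`: the size of its neighbourhood. -/
def deg (I : GraphInput loops n d₀ dₑ) (v : Fin n) : ℕ := (I.nbrs v).length

/-- All node features, all features of edges, and the parameter vector have 2-norm at most `B`. -/
def BoundedBy {P : Type} [Fintype P] (I : GraphInput loops n d₀ dₑ) (θ : EuclideanSpace ℝ P)
    (B : ℝ) : Prop :=
  (∀ i, ‖I.feature i‖ ≤ B) ∧ (∀ i, ∀ u ∈ I.nbrs i, ‖I.edge i u‖ ≤ B) ∧ ‖θ‖ ≤ B

end GraphInput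

/-- A one-layer message passing neural network, with parameters in `ℝ^P`. The message function
`M i u dᵢ dᵤ zᵢ zᵤ e θ` may depend on the two nodes and on their degrees `dᵢ`, `dᵤ`;
`loops` records whether the model includes the centre node in its own neighbourhood. -/
structure OneLayerMPNN (d₀ dₑ dₕ d₁ : ℕ) (P : Type) [Fintype P] where
  loops : Bool
  M : {n : ℕ} → (i u : Fin n) → (degi degu : ℕ) →
    Vec d₀ → Vec d₀ → Vec dₑ → EuclideanSpace ℝ P → Vec dₕ
  U : Vec d₀ → Vec dₕ → EuclideanSpace ℝ P → Vec d₁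

namespace OneLayerMPNN

variable {d₀ dₑ dₕ d₁ : ℕ} {P : Type} [Fintype P]

/-- The exact embedding `z_v = U(x_v, ∑_{u ∈ 𝒩(v)} M_{vu}(x_v, x_u, e_{vu}, θ), θ)`. -/
noncomputable def embed (N : OneLayerMPNN d₀ dₑ dₕ d₁ P) {n : ℕ}
    (I : GraphInput N.loops n d₀ dₑ) (θ : EuclideanSpace ℝ P) (v : Fin n) : Vec d₁ :=
  N.U (I.feature v)
    ((I.nbrs v).map fun u =>
      N.M v u (I.deg v) (I.deg u) (I.feature v) (I.feature u) (I.edge v u) θ).sum θ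

/-- On every bounded domain, `U` and all the functions `deg(i) M_{iu}` are Lipschitz, with a
constant that does not depend on the graph or on the nodes; the functions `deg(i) M_{iu}` are
moreover bounded at the origin, uniformly in the graph and the nodes. -/
def LipschitzOnBounded (N : OneLayerMPNN d₀ dₑ dₕ d₁ P) : Prop :=
  ∀ R : ℝ, ∃ K : ℝ≥0,
    LipschitzOnWith K
      (fun p : Vec d₀ × Vec dₕ × EuclideanSpace ℝ P => N.U p.1 p.2.1 p.2.2)
      (Metric.closedBall 0 R) ∧
    ∀ (n : ℕ) (I : GraphInput N.loops n d₀ dₑ) (i u : Fin n), u ∈ I.nbrs i →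
      LipschitzOnWith K
        (fun p : Vec d₀ × Vec d₀ × Vec dₑ × EuclideanSpace ℝ P =>
          (I.deg i : ℝ) • N.M i u (I.deg i) (I.deg u) p.1 p.2.1 p.2.2.1 p.2.2.2)
        (Metric.closedBall 0 R) ∧
      ‖(I.deg i : ℝ) • N.M i u (I.deg i) (I.deg u) 0 0 0 0‖ ≤ K

end OneLayerMPNN

/-- One-layer GraphSAGE-GCN with activation `σ` (applied to each coordinate) and parameter matrix
`W ∈ ℝ^{d₁ × d₀}`: `M_{vu} = z_u / deg(v)` and `U = σ(W h_v)`, the centre node being included in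
its own neighbourhood. -/
noncomputable def graphSageGCN (σ : ℝ → ℝ) (d₀ dₑ d₁ : ℕ) :
    OneLayerMPNN d₀ dₑ d₀ d₁ (Fin d₁ × Fin d₀) where
  loops := true
  M := fun _ _ degi _ _ zu _ _ => (degi : ℝ)⁻¹ • zu
  U := fun _ h W => WithLp.toLp 2 fun i => σ (∑ j, W (i, j) * h j)

/-- The oracle queries: the degree of a node, its `i`-th neighbour, its feature. -/
inductive Query (n : ℕ) : Type
  | deg (v : Fin n)
  | nbr (v : Fin n) (i : ℕ)
  | feature (v : Fin n)

/-- The type of the answer to a query. A neighbour query returns the neighbour together with the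
feature of the connecting edge, or `none` if the index is out of range. -/
def Query.Answer {n : ℕ} (d₀ dₑ : ℕ) : Query n → Type
  | .deg _ => ℕ
  | .nbr _ _ => Option (Fin n × Vec dₑ)
  | .feature _ => Vec d₀

/-- The oracles of an input (indices of neighbours start at `0`). -/
def GraphInput.oracle {loops : Bool} {n d₀ dₑ : ℕ} (I : GraphInput loops n d₀ dₑ) :
    (q : Query n) → q.Answer d₀ dₑ
  | .deg v => I.deg v
  | .nbr v i => ((I.nbrs v)[i]?).map fun u => (u, I.edge v u)
  | .feature v => I.feature v

/-- A deterministic adaptive query algorithm with output in `ℝ^{d₁}`: a decision tree which either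
returns a vector or asks a query and continues in a way that depends on the answer. -/
inductive DecisionTree (n d₀ dₑ d₁ : ℕ) : Type
  | ret (z : Vec d₁)
  | ask (q : Query n) (k : q.Answer d₀ dₑ → DecisionTree n d₀ dₑ d₁)

namespace DecisionTree

variable {loops : Bool} {n d₀ dₑ d₁ : ℕ}

/-- The output on an input. -/
def run (I : GraphInput loops n d₀ dₑ) : DecisionTree n d₀ dₑ d₁ → Vec d₁
  | ret z => z
  | ask q k => (k (I.oracle q)).run I

/-- The number of queries made on an input. -/
def queries (I : GraphInput loops n d₀ dₑ) : DecisionTree n d₀ dₑ d₁ → ℕ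
  | ret _ => 0
  | ask q k => (k (I.oracle q)).queries I + 1

end DecisionTree

/-- A randomized adaptive query algorithm: a random decision tree, over an arbitrary probability
space, whose output and number of queries on every input are random variables. -/
structure RandomizedAlgorithm (loops : Bool) (n d₀ dₑ d₁ : ℕ) where
  Ω : Type
  [measurableSpace : MeasurableSpace Ω]
  prob : Measure Ω
  [isProbabilityMeasure : IsProbabilityMeasure prob]
  tree : Ω → DecisionTree n d₀ dₑ d₁
  measurable_run : ∀ I : GraphInput loops n d₀ dₑ, Measurable fun ω => (tree ω).run I
  measurable_queries : ∀ I : GraphInput loops n d₀ dₑ, Measurable fun ω => (tree ω).queries I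

namespace RandomizedAlgorithm

variable {loops : Bool} {n d₀ dₑ d₁ : ℕ}

attribute [instance] RandomizedAlgorithm.measurableSpace RandomizedAlgorithm.isProbabilityMeasure

/-- The probability that the output on the input `I` is at distance at least `ε` from `z`. -/
noncomputable def errorProb (A : RandomizedAlgorithm loops n d₀ dₑ d₁)
    (I : GraphInput loops n d₀ dₑ) (z : Vec d₁) (ε : ℝ) : ℝ :=
  A.prob.real {ω | ε ≤ ‖(A.tree ω).run I - z‖}

/-- The expected number of queries on the input `I`. -/
noncomputable def expectedQueries (A : RandomizedAlgorithm loops n d₀ dₑ d₁)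
    (I : GraphInput loops n d₀ dₑ) : ℝ≥0∞ :=
  ∫⁻ ω, ((A.tree ω).queries I : ℝ≥0∞) ∂A.prob

end RandomizedAlgorithm

namespace OneLayerMPNN

variable {d₀ dₑ dₕ d₁ : ℕ} {P : Type} [Fintype P]

/-- `A`, which is given the number of nodes, the target node and the parameters, and accesses the
input only by queries, estimates the embedding of the target node up to an error smaller than `ε`
with probability at least `1 - δ`, on all inputs bounded by `B`. -/
def ApproximatedBy (N : OneLayerMPNN d₀ dₑ dₕ d₁ P)
    (A : (n : ℕ) → Fin n → EuclideanSpace ℝ P → RandomizedAlgorithm N.loops n d₀ dₑ d₁)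
    (B ε δ : ℝ) : Prop :=
  ∀ (n : ℕ) (v : Fin n) (θ : EuclideanSpace ℝ P) (I : GraphInput N.loops n d₀ dₑ),
    I.BoundedBy θ B → (A n v θ).errorProb I (N.embed I θ v) ε ≤ δ

/-- The loop of neighbor sampling: look up the neighbours of `v` with the listed indices, add up
their messages, and pass the sum on to `finish`. -/
noncomputable def sampleLoop (N : OneLayerMPNN d₀ dₑ dₕ d₁ P) {n : ℕ} (v : Fin n)
    (θ : EuclideanSpace ℝ P) (dv : ℕ) (xv : Vec d₀)
    (finish : Vec dₕ → DecisionTree n d₀ dₑ d₁) :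
    List ℕ → Vec dₕ → DecisionTree n d₀ dₑ d₁
  | [], acc => finish acc
  | i :: is, acc =>
    .ask (.nbr v i) fun a : Option (Fin n × Vec dₑ) =>
      match a with
      | none => sampleLoop N v θ dv xv finish is acc
      | some (u, e) =>
        .ask (.feature u) fun xu : Vec d₀ =>
        .ask (.deg u) fun du : ℕ =>
          sampleLoop N v θ dv xv finish is (acc + N.M v u dv du xv xu e θ)

/-- Neighbor sampling with `r` samples: `r` neighbours of `v` are drawn uniformly with replacement
and the estimate is `U(x_v, (deg(v) / r) ∑ M_{vu}, θ)`, the sum being over the sample. The random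
seed holds, for each sample `k` and each possible degree `m + 1`, an independent uniform element
`ω k m` of `{0, …, m}`; only the entries with `m + 1 = deg(v)` are used. (For an isolated node all
lookups fail and the sum is `0`.) -/
noncomputable def neighborSampling (N : OneLayerMPNN d₀ dₑ dₕ d₁ P) (r n : ℕ) (v : Fin n)
    (θ : EuclideanSpace ℝ P) : RandomizedAlgorithm N.loops n d₀ dₑ d₁ where
  Ω := Fin r → (m : Fin n) → Fin (m + 1)
  prob := Measure.pi fun _ => Measure.pi fun m => (PMF.uniformOfFintype (Fin (m + 1))).toMeasure
  tree := fun ω =>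
    .ask (.deg v) fun dv : ℕ =>
    .ask (.feature v) fun xv : Vec d₀ =>
      N.sampleLoop v θ dv xv (fun acc => .ret (N.U xv (((dv : ℝ) / (r : ℝ)) • acc) θ))
        (List.ofFn fun k => if hd : dv - 1 < n then (ω k ⟨dv - 1, hd⟩ : ℕ) else 0) 0
  measurable_run := fun _ => .of_discrete
  measurable_queries := fun _ => .of_discrete

end OneLayerMPNN

/-! Upper bound. `deg(v)` times the message of a uniformly drawn neighbour is a bounded unbiased
estimate of `h_v`. Hoeffding's inequality puts the mean of `O(ε⁻² log(1/δ))` samples within `O(ε)`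
of `h_v`, and the local Lipschitz bound on `U` carries this over to `z_v`
(`errorProb_neighborSampling_le`).

Lower bound. Take the complete graph with loops, with features chosen between two vectors by
independent bits of bias `r`. Degree and neighbour queries reveal nothing, a feature query reveals
one bit, and the embedding is governed by `σ(μ)`, where `μ` concentrates at an affine function of
`r` for large `n`. An accurate algorithm therefore recognizes `r` among `k` candidates whose
`σ`-values are `4ε` apart. `exists_separated_values` finds such candidates at mutual distance
`O(ε)`, so one bit carries relative entropy at most `κ = O(ε²)`. As `δ` may be close to `1`, two
candidates do not suffice: `k > 6/(1-δ)` recognition probabilities of at least `(1-δ)/2` add up to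
more than `3`, whereas comparison with one reference bias bounds the sum by `2 + kκq` for `q`
expected queries (`sum_recognition_le`). Hence `q` is at least of order `ε⁻²`.

The comparison rests on `DecisionTree.gibbs`, the inequality `E_Q[F - κ·queries] ≤ log E_P[exp F]`,
proved by induction on the tree. Conditioning on a queried bit keeps both laws products, and the
one-bit inequality `bernoulli_gibbs` glues the two subtrees; this is the chain rule for relative
entropy without transcripts. -/

/-! ### Product Bernoulli laws on bit strings -/

/-- The probability of the bit string `x` when its bits are independent and `P u` is the
probability that the bit `u` is set. -/
noncomputable def bernoulliWeight {ι : Type*} [Fintype ι] (P : ι → ℝ) (x : ι → Bool) : ℝ :=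
  ∏ u, if x u then P u else 1 - P u

section BernoulliWeight

variable {ι : Type*} [Fintype ι]

theorem bernoulliWeight_nonneg {P : ι → ℝ} (hP : ∀ u, P u ∈ Set.Icc (0 : ℝ) 1) (x : ι → Bool) :
    0 ≤ bernoulliWeight P x := by
  refine Finset.prod_nonneg fun u _ => ?_
  have := hP u
  split_ifs
  · exact this.1
  · linarith [this.2]

variable [DecidableEq ι]

theorem sum_prod_bool (g : ι → Bool → ℝ) :
    ∑ x : ι → Bool, ∏ u, g u (x u) = ∏ u, (g u true + g u false) := by
  have := Finset.prod_univ_sum (fun _ : ι => (Finset.univ : Finset Bool)) g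
  rw [Fintype.piFinset_univ] at this
  rw [← this]
  simp

theorem sum_bernoulliWeight (P : ι → ℝ) : ∑ x, bernoulliWeight P x = 1 := by
  have := sum_prod_bool fun u b => if b then P u else 1 - P u
  simpa [bernoulliWeight] using this

theorem bernoulliWeight_update (P : ι → ℝ) (u : ι) (c : ℝ) (x : ι → Bool) :
    bernoulliWeight (Function.update P u c) x =
      (if x u then c else 1 - c) *
        ∏ w ∈ Finset.univ.erase u, if x w then P w else 1 - P w := by
  rw [bernoulliWeight, ← Finset.mul_prod_erase _ _ (Finset.mem_univ u)]
  congr 1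
  · simp
  · refine Finset.prod_congr rfl fun w hw => ?_
    rw [Function.update_of_ne (Finset.ne_of_mem_erase hw)]

theorem bernoulliWeight_split (P : ι → ℝ) (u : ι) (x : ι → Bool) :
    bernoulliWeight P x = (1 - P u) * bernoulliWeight (Function.update P u 0) x +
      P u * bernoulliWeight (Function.update P u 1) x := by
  conv_lhs => rw [← Function.update_eq_self u P]
  simp only [bernoulliWeight_update]
  split_ifs <;> ring

/-- Conditioning on the bit `u`: the conditional laws are again products, with the probability at
`u` replaced by 0 or 1. This is what makes the induction on decision trees possible. -/
theorem sum_bernoulliWeight_mul_split (P : ι → ℝ) (u : ι) (G : (ι → Bool) → ℝ) :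
    ∑ x, bernoulliWeight P x * G x =
      (1 - P u) * ∑ x, bernoulliWeight (Function.update P u 0) x * G x +
      P u * ∑ x, bernoulliWeight (Function.update P u 1) x * G x := by
  rw [Finset.mul_sum, Finset.mul_sum, ← Finset.sum_add_distrib]
  refine Finset.sum_congr rfl fun x _ => ?_
  rw [bernoulliWeight_split P u x]
  ring

/-- Strings with the opposite bit at `u` have no mass, so below a query of `u` the tree may be
replaced by the subtree of the known answer. -/
theorem sum_bernoulliWeight_zero_congr (P : ι → ℝ) (u : ι) {G H : (ι → Bool) → ℝ}
    (h : ∀ x, x u = false → G x = H x) :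
    ∑ x, bernoulliWeight (Function.update P u 0) x * G x =
      ∑ x, bernoulliWeight (Function.update P u 0) x * H x := by
  refine Finset.sum_congr rfl fun x _ => ?_
  cases hx : x u
  · rw [h x hx]
  · simp [bernoulliWeight_update, hx]

theorem sum_bernoulliWeight_one_congr (P : ι → ℝ) (u : ι) {G H : (ι → Bool) → ℝ}
    (h : ∀ x, x u = true → G x = H x) :
    ∑ x, bernoulliWeight (Function.update P u 1) x * G x =
      ∑ x, bernoulliWeight (Function.update P u 1) x * H x := by
  refine Finset.sum_congr rfl fun x _ => ?_
  cases hx : x u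
  · simp [bernoulliWeight_update, hx]
  · rw [h x hx]

/-- The second moment of the number of set bits about its mean. -/
theorem sum_bernoulliWeight_sq (p : ℝ) :
    ∑ x : ι → Bool, bernoulliWeight (fun _ => p) x * (∑ u, ((if x u then 1 else 0) - p)) ^ 2 =
      Fintype.card ι * (p * (1 - p)) := by
  have key : ∀ u w : ι, ∑ x : ι → Bool, bernoulliWeight (fun _ => p) x *
      (((if x u then 1 else 0) - p) * ((if x w then 1 else 0) - p)) =
        if u = w then p * (1 - p) else 0 := by
    intro u w
    -- The weight and both centred bits are written as one product over coordinates, so that the sum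
    -- factorizes.
    have h := sum_prod_bool (ι := ι) fun i b => (if b then p else 1 - p) *
      ((if i = u then (if b then 1 else 0) - p else 1) *
        (if i = w then (if b then 1 else 0) - p else 1))
    simp only [Finset.prod_mul_distrib, Finset.prod_ite_eq', Finset.mem_univ, if_true] at h
    refine Eq.trans (by rfl) (h.trans ?_)
    -- For `u = w` all factors other than the one at `u` are `p + (1 - p) = 1`; for `u ≠ w` the
    -- factor at `u` is the mean of a centred bit, which is 0.
    rw [← Finset.mul_prod_erase _ _ (Finset.mem_univ u)]
    by_cases huw : u = w
    · subst huw
      rw [Finset.prod_eq_one]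
      · simp; ring
      · intro i hi
        simp [Finset.ne_of_mem_erase hi]
    · simp only [if_pos, huw, if_false, mul_one]
      convert zero_mul _
      simp; ring
  simp_rw [sq, Finset.sum_mul_sum, Finset.mul_sum]
  rw [Finset.sum_comm]
  simp_rw [Finset.sum_comm (s := (Finset.univ : Finset (ι → Bool)))]
  simp [key]

end BernoulliWeight

/-! ### Relative entropy along a decision tree -/

/-- A Gibbs variational inequality on two points: the relative entropy is bounded by the
chi-squared divergence. -/
theorem bernoulli_gibbs {p q κ : ℝ} (hp : p ∈ Set.Ioo (0 : ℝ) 1) (hq : q ∈ Set.Ioo (0 : ℝ) 1)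
    (hκ : (q - p) ^ 2 / (p * (1 - p)) ≤ κ) (a b : ℝ) :
    (1 - q) * a + q * b - κ ≤ Real.log ((1 - p) * Real.exp a + p * Real.exp b) := by
  obtain ⟨hp0, hp1⟩ := hp
  obtain ⟨hq0, hq1⟩ := hq
  have hp1' : 0 < 1 - p := by linarith
  have hq1' : 0 < 1 - q := by linarith
  set Z := (1 - p) * Real.exp a + p * Real.exp b with hZ
  have hZ0 : 0 < Z := by positivity
  -- With `r` the old and `s` the new weight of an outcome, `log x ≤ x - 1` is applied to the tilted
  -- ratio `r exp t / (Z s)` and to `s / r`. Summed over both outcomes, the first contributions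
  -- cancel and the second give the chi-squared divergence.
  have step : ∀ r s t : ℝ, 0 < r → 0 < s →
      s * (t - Real.log Z) ≤ r * Real.exp t / Z - s + (s ^ 2 / r - s) := by
    intro r s t hr hs
    have e : t - Real.log Z = Real.log (r * Real.exp t / (Z * s)) + Real.log (s / r) := by
      rw [← Real.log_mul (by positivity) (by positivity)]
      rw [show r * Real.exp t / (Z * s) * (s / r) = Real.exp t / Z by field_simp]
      rw [Real.log_div (by positivity) (by positivity), Real.log_exp]
    have h1 := Real.log_le_sub_one_of_pos (show 0 < r * Real.exp t / (Z * s) by positivity)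
    have h2 := Real.log_le_sub_one_of_pos (show 0 < s / r by positivity)
    calc s * (t - Real.log Z) ≤ s * (r * Real.exp t / (Z * s) - 1 + (s / r - 1)) := by
          rw [e]; gcongr
      _ = _ := by field_simp
  have h1 := step _ _ a hp1' hq1'
  have h2 := step _ _ b hp0 hq0
  have h3 : (1 - p) * Real.exp a / Z + p * Real.exp b / Z = 1 := by
    rw [← add_div, ← hZ, div_self hZ0.ne']
  have h4 : (1 - q) ^ 2 / (1 - p) + q ^ 2 / p - 1 = (q - p) ^ 2 / (p * (1 - p)) := by
    field_simp; ring
  linarith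

/-- Jensen's inequality for the exponential on two points. -/
theorem bernoulli_jensen {p κ : ℝ} (hp : p ∈ Set.Icc (0 : ℝ) 1) (hκ : 0 ≤ κ) (a b : ℝ) :
    (1 - p) * a + p * b - κ ≤ Real.log ((1 - p) * Real.exp a + p * Real.exp b) := by
  have h := convexOn_exp.2 (Set.mem_univ a) (Set.mem_univ b) (sub_nonneg.2 hp.2) hp.1
    (by ring)
  simp only [smul_eq_mul] at h
  have := (Real.le_log_iff_exp_le ((Real.exp_pos _).trans_le h)).2 h
  linarith

/-- The complete graph with loops, whose node features are chosen among two vectors by the bit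
string `x`. -/
def completeInput {n d₀ : ℕ} (dₑ : ℕ) (y₀ y₁ : Vec d₀) (x : Fin n → Bool) :
    GraphInput true n d₀ dₑ where
  graph := ⊤
  nbrs := fun _ => List.finRange n
  nodup_nbrs := fun _ => List.nodup_finRange n
  mem_nbrs := fun v u => by simp [SimpleGraph.top_adj, eq_comm (a := v), ne_or_eq]
  feature := fun i => if x i then y₁ else y₀
  edge := fun _ _ => 0

/-- A decision tree with few expected queries cannot tell two product distributions of the bit
string apart: a Gibbs variational inequality along the tree. `κ` bounds the relative entropy
of one bit. -/
theorem DecisionTree.gibbs {n d₀ dₑ d₁ : ℕ} (y₀ y₁ : Vec d₀) (F : Vec d₁ → ℝ) {κ : ℝ}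
    (hκ : 0 ≤ κ) (T : DecisionTree n d₀ dₑ d₁) :
    ∀ P Q : Fin n → ℝ, (∀ u, P u ∈ Set.Icc (0 : ℝ) 1) → (∀ u, Q u ∈ Set.Icc (0 : ℝ) 1) →
    (∀ u a b, (1 - Q u) * a + Q u * b - κ ≤
      Real.log ((1 - P u) * Real.exp a + P u * Real.exp b)) →
    ∑ x, bernoulliWeight Q x *
        (F (T.run (completeInput dₑ y₀ y₁ x)) - κ * T.queries (completeInput dₑ y₀ y₁ x)) ≤
      Real.log (∑ x, bernoulliWeight P x *
        Real.exp (F (T.run (completeInput dₑ y₀ y₁ x)))) := by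
  induction T with
  | ret z =>
    intro P Q _ _ _
    simp [DecisionTree.run, DecisionTree.queries, ← Finset.sum_mul, sum_bernoulliWeight]
  | ask q k ih =>
    intro P Q hP hQ h
    -- Degree and neighbour answers do not depend on the bits: the tree moves to a fixed child, and
    -- the charge `κ ≥ 0` only helps.
    have const : ∀ c, (∀ x : Fin n → Bool, (completeInput dₑ y₀ y₁ x).oracle q = c) →
        ∑ x, bernoulliWeight Q x * (F ((DecisionTree.ask q k).run (completeInput dₑ y₀ y₁ x)) -
          κ * (DecisionTree.ask q k).queries (completeInput dₑ y₀ y₁ x)) ≤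
        Real.log (∑ x, bernoulliWeight P x *
          Real.exp (F ((DecisionTree.ask q k).run (completeInput dₑ y₀ y₁ x)))) := by
      intro c hc
      simp only [DecisionTree.run, DecisionTree.queries, hc]
      refine le_trans (Finset.sum_le_sum fun x _ => ?_) (ih c P Q hP hQ h)
      refine mul_le_mul_of_nonneg_left ?_ (bernoulliWeight_nonneg hQ x)
      push_cast
      linarith
    cases q with
    | deg v => exact const ((completeInput dₑ y₀ y₁ fun _ => false).oracle (.deg v)) fun _ => rfl
    | nbr v i =>
      exact const ((completeInput dₑ y₀ y₁ fun _ => false).oracle (.nbr v i)) fun _ => rfl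
    | feature u =>
      simp only [DecisionTree.run, DecisionTree.queries]
      have upd : ∀ (R : Fin n → ℝ) (c : ℝ), c ∈ Set.Icc (0 : ℝ) 1 →
          (∀ w, R w ∈ Set.Icc (0 : ℝ) 1) →
          ∀ w, Function.update R u c w ∈ Set.Icc (0 : ℝ) 1 := by
        intro R c hc hR w
        by_cases hw : w = u
        · subst hw; simpa using hc
        · simpa [Function.update_of_ne hw] using hR w
      have m0 : (0 : ℝ) ∈ Set.Icc (0 : ℝ) 1 := by simp
      have m1 : (1 : ℝ) ∈ Set.Icc (0 : ℝ) 1 := by simp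
      -- A bit that has been read has the same probability under both laws, so Jensen's inequality
      -- suffices there; the chi-squared bound would divide by 0. This is why the induction assumes
      -- the one-bit inequality itself.
      have hupd : ∀ c : ℝ, c ∈ Set.Icc (0 : ℝ) 1 → ∀ w a b,
          (1 - Function.update Q u c w) * a + Function.update Q u c w * b - κ ≤
          Real.log ((1 - Function.update P u c w) * Real.exp a +
            Function.update P u c w * Real.exp b) := by
        intro c hc w a b
        by_cases hw : w = u
        · subst hw; simpa using bernoulli_jensen hc hκ a b
        · simpa [Function.update_of_ne hw] using h w a b
      have i0 := ih y₀ _ _ (upd P 0 m0 hP) (upd Q 0 m0 hQ) (hupd 0 m0)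
      have i1 := ih y₁ _ _ (upd P 1 m1 hP) (upd Q 1 m1 hQ) (hupd 1 m1)
      have pos : ∀ (R : Fin n → ℝ) (G : (Fin n → Bool) → ℝ), (∀ w, R w ∈ Set.Icc (0 : ℝ) 1) →
          0 < ∑ x, bernoulliWeight R x * Real.exp (G x) := by
        intro R G hR
        refine lt_of_le_of_ne (Finset.sum_nonneg fun x _ => mul_nonneg
          (bernoulliWeight_nonneg hR x) (Real.exp_pos _).le) fun h0 => ?_
        have hz := (Finset.sum_eq_zero_iff_of_nonneg fun x _ => mul_nonneg
          (bernoulliWeight_nonneg hR x) (Real.exp_pos (G x)).le).1 h0.symm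
        have := sum_bernoulliWeight R
        rw [Finset.sum_eq_zero] at this
        · exact zero_ne_one this
        · intro x hx
          exact (mul_eq_zero.1 (hz x hx)).resolve_right (Real.exp_pos _).ne'
      have p0 := pos _ (fun x => F ((k y₀).run (completeInput dₑ y₀ y₁ x))) (upd P 0 m0 hP)
      have p1 := pos _ (fun x => F ((k y₁).run (completeInput dₑ y₀ y₁ x))) (upd P 1 m1 hP)
      have o0 : ∀ x : Fin n → Bool, x u = false →
          (completeInput dₑ y₀ y₁ x).oracle (.feature u) = y₀ := fun x hx => by
        simp [GraphInput.oracle, completeInput, hx]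
        rfl
      have o1 : ∀ x : Fin n → Bool, x u = true →
          (completeInput dₑ y₀ y₁ x).oracle (.feature u) = y₁ := fun x hx => by
        simp [GraphInput.oracle, completeInput, hx]
        rfl
      -- The one-bit inequality at `u`, evaluated at the log-moments of the two subtrees; its `κ`
      -- pays for the present query.
      have hg := h u (Real.log (∑ x, bernoulliWeight (Function.update P u 0) x *
          Real.exp (F ((k y₀).run (completeInput dₑ y₀ y₁ x)))))
        (Real.log (∑ x, bernoulliWeight (Function.update P u 1) x *
          Real.exp (F ((k y₁).run (completeInput dₑ y₀ y₁ x)))))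
      rw [Real.exp_log p0, Real.exp_log p1] at hg
      rw [sum_bernoulliWeight_mul_split P u, sum_bernoulliWeight_mul_split Q u,
        sum_bernoulliWeight_zero_congr P u (H := fun x =>
          Real.exp (F ((k y₀).run (completeInput dₑ y₀ y₁ x)))) fun x hx => by rw [o0 x hx],
        sum_bernoulliWeight_one_congr P u (H := fun x =>
          Real.exp (F ((k y₁).run (completeInput dₑ y₀ y₁ x)))) fun x hx => by rw [o1 x hx],
        sum_bernoulliWeight_zero_congr Q u (H := fun x =>
          (F ((k y₀).run (completeInput dₑ y₀ y₁ x)) -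
            κ * (k y₀).queries (completeInput dₑ y₀ y₁ x)) - κ)
          fun x hx => by rw [o0 x hx]; push_cast; ring,
        sum_bernoulliWeight_one_congr Q u (H := fun x =>
          (F ((k y₁).run (completeInput dₑ y₀ y₁ x)) -
            κ * (k y₁).queries (completeInput dₑ y₀ y₁ x)) - κ)
          fun x hx => by rw [o1 x hx]; push_cast; ring]
      refine le_trans ?_ hg
      simp only [mul_sub _ _ κ, Finset.sum_sub_distrib, ← Finset.sum_mul, sum_bernoulliWeight]
      have := mul_le_mul_of_nonneg_left i0 (sub_nonneg.2 (hQ u).2)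
      have := mul_le_mul_of_nonneg_left i1 (hQ u).1
      linarith

/-- If a set of outputs has probability `Q` under one distribution and `P` under another, then
`Q` exceeds `(e - 1) P` by at most the relative entropy of the observed bits. -/
theorem DecisionTree.change_of_measure {n d₀ dₑ d₁ : ℕ} (y₀ y₁ : Vec d₀) (E : Set (Vec d₁))
    {p q κ : ℝ} (hp : p ∈ Set.Ioo (0 : ℝ) 1) (hq : q ∈ Set.Ioo (0 : ℝ) 1)
    (hκ : (q - p) ^ 2 / (p * (1 - p)) ≤ κ) (T : DecisionTree n d₀ dₑ d₁) :
    ∑ x, bernoulliWeight (fun _ => q) x *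
        (E.indicator 1 (T.run (completeInput dₑ y₀ y₁ x)) -
          κ * T.queries (completeInput dₑ y₀ y₁ x)) ≤
      2 * ∑ x, bernoulliWeight (fun _ => p) x *
        E.indicator 1 (T.run (completeInput dₑ y₀ y₁ x)) := by
  have hp1 : 0 < 1 - p := sub_pos.2 hp.2
  have hp0 := hp.1
  have hκ0 : 0 ≤ κ := le_trans (by positivity) hκ
  refine (DecisionTree.gibbs y₀ y₁ (E.indicator 1) hκ0 T (fun _ => p) (fun _ => q)
    (fun _ => Set.Ioo_subset_Icc_self hp) (fun _ => Set.Ioo_subset_Icc_self hq)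
    (fun _ => bernoulli_gibbs hp hq hκ)).trans ?_
  set f : (Fin n → Bool) → ℝ := fun x => E.indicator 1 (T.run (completeInput dₑ y₀ y₁ x))
  -- `f` takes only the values 0 and 1, and `e ≤ 3`; then `log y ≤ y - 1` removes the logarithm.
  have hf : ∀ x, Real.exp (f x) ≤ 1 + 2 * f x := by
    intro x
    by_cases hx : T.run (completeInput dₑ y₀ y₁ x) ∈ E
    · simp only [f, Set.indicator_of_mem hx, Pi.one_apply]
      linarith [Real.exp_one_lt_d9]
    · simp [f, Set.indicator_of_notMem hx]
  have hW := bernoulliWeight_nonneg (P := fun _ : Fin n => p)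
    fun _ => Set.Ioo_subset_Icc_self hp
  have hsum : ∑ x, bernoulliWeight (fun _ : Fin n => p) x * Real.exp (f x) ≤
      1 + 2 * ∑ x, bernoulliWeight (fun _ => p) x * f x := by
    rw [← sum_bernoulliWeight (fun _ : Fin n => p), Finset.mul_sum, ← Finset.sum_add_distrib]
    refine Finset.sum_le_sum fun x _ => ?_
    nlinarith [mul_le_mul_of_nonneg_left (hf x) (hW x)]
  have hpos : 0 < ∑ x, bernoulliWeight (fun _ : Fin n => p) x * Real.exp (f x) := by
    refine lt_of_lt_of_le one_pos ?_
    rw [← sum_bernoulliWeight (fun _ : Fin n => p)]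
    refine Finset.sum_le_sum fun x _ => le_mul_of_one_le_right (hW x) (Real.one_le_exp ?_)
    exact Set.indicator_nonneg (by simp) _
  have := Real.log_le_sub_one_of_pos hpos
  change Real.log (∑ x, bernoulliWeight (fun _ : Fin n => p) x * Real.exp (f x)) ≤
    2 * ∑ x, bernoulliWeight (fun _ => p) x * f x
  linarith

/-! ### Separated candidates and their recognition -/

/-- A continuous function that varies by `D` on `[a, b]` takes `k` values at mutual distance at
least `4 * ε` in a subset of `[a, b]` of diameter `O(ε)`. -/
theorem exists_separated_values {σ : ℝ → ℝ} (hσ : Continuous σ) {a b D ε : ℝ} {k : ℕ}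
    (hab : a < b) (hD : |σ b - σ a| = D) (hk : 0 < k) (hε : 0 < ε) (hεD : 4 * k * ε ≤ D) :
    ∃ t : Fin k → ℝ, (∀ j, t j ∈ Set.Icc a b) ∧
      (∀ i j, |t i - t j| ≤ 8 * k * ε * (b - a) / D) ∧
      ∀ i j, i ≠ j → 4 * ε ≤ |σ (t i) - σ (t j)| := by
  have hk' : (0 : ℝ) < k := Nat.cast_pos.2 hk
  have hkε : 0 < 4 * k * ε := by positivity
  have hD0 : 0 < D := hkε.trans_le hεD
  have hba : 0 < b - a := sub_pos.2 hab
  -- Of `m` equal pieces of `[a, b]`, one has increment at least `D / m ≥ 4kε`. Rounding down loses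
  -- at most a factor 2, whence the length bound with `8` in place of `4`.
  set m := ⌊D / (4 * k * ε)⌋₊ with hm
  have h1 : 1 ≤ D / (4 * k * ε) := (one_le_div hkε).2 hεD
  have hm1 : 1 ≤ m := (Nat.one_le_floor_iff _).2 h1
  have hm0 : (0 : ℝ) < m := by exact_mod_cast hm1
  have hmle : (m : ℝ) ≤ D / (4 * k * ε) := Nat.floor_le (by positivity)
  have hmge : D / (4 * k * ε) ≤ 2 * m := by
    have := Nat.lt_floor_add_one (D / (4 * k * ε))
    have : (1 : ℝ) ≤ m := by exact_mod_cast hm1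
    linarith
  set s : ℕ → ℝ := fun i => a + i * ((b - a) / m) with hs
  have hs0 : s 0 = a := by simp [hs]
  have hsm : s m = b := by simp only [hs]; field_simp; ring
  have hstep : ∀ i, s (i + 1) - s i = (b - a) / m := by
    intro i; simp only [hs]; push_cast; ring
  -- Pigeonhole on the telescoping sum of increments.
  obtain ⟨i, him, hi⟩ : ∃ i < m, D / m ≤ |σ (s (i + 1)) - σ (s i)| := by
    by_contra! hcon
    have e := Finset.sum_range_sub (fun i => σ (s i)) m
    rw [hs0, hsm] at e
    have : D < D := by
      calc D = |∑ i ∈ Finset.range m, (σ (s (i + 1)) - σ (s i))| := by rw [e, hD]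
        _ ≤ ∑ i ∈ Finset.range m, |σ (s (i + 1)) - σ (s i)| := Finset.abs_sum_le_sum_abs _ _
        _ < ∑ i ∈ Finset.range m, D / m :=
          Finset.sum_lt_sum_of_nonempty (Finset.nonempty_range_iff.2 (by omega))
            fun i hi => hcon i (Finset.mem_range.1 hi)
        _ = D := by simp; field_simp
    exact lt_irrefl _ this
  have hle : s i ≤ s (i + 1) := by
    have := hstep i
    have : 0 < (b - a) / m := by positivity
    linarith
  have hgap : 4 * k * ε ≤ |σ (s (i + 1)) - σ (s i)| := by
    refine le_trans ?_ hi
    rw [le_div_iff₀ hm0]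
    rw [le_div_iff₀ hkε] at hmle
    linarith
  have hlen : (b - a) / m ≤ 8 * k * ε * (b - a) / D := by
    rw [div_le_iff₀ hkε] at hmge
    rw [div_le_div_iff₀ hm0 hD0]
    nlinarith
  -- The intermediate value theorem yields `k` equally spaced values, with spacing the increment
  -- over `k`, hence at least `4ε`.
  have hex : ∀ j : Fin k, ∃ t ∈ Set.Icc (s i) (s (i + 1)),
      σ t = σ (s i) + (j : ℝ) / k * (σ (s (i + 1)) - σ (s i)) := by
    intro j
    have := intermediate_value_uIcc (a := s i) (b := s (i + 1)) hσ.continuousOn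
    rw [Set.uIcc_of_le hle] at this
    refine this ?_
    have hj0 : (0 : ℝ) ≤ (j : ℝ) / k := by positivity
    have hj1 : (j : ℝ) / k ≤ 1 := (div_le_one hk').2 (by exact_mod_cast j.2.le)
    rcases le_total (σ (s i)) (σ (s (i + 1))) with h | h
    · rw [Set.uIcc_of_le h]
      constructor <;> nlinarith
    · rw [Set.uIcc_of_ge h]
      constructor <;> nlinarith
  choose t ht hval using hex
  have ha : a ≤ s i := by
    have : (0 : ℝ) ≤ i * ((b - a) / m) := by positivity
    simp only [hs]; linarith
  have hb : s (i + 1) ≤ b := by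
    rw [← hsm]
    have : ((i + 1 : ℕ) : ℝ) ≤ m := by exact_mod_cast him
    simp only [hs]
    gcongr
  refine ⟨t, fun j => ⟨ha.trans (ht j).1, (ht j).2.trans hb⟩, fun j l => ?_, fun j l hjl => ?_⟩
  · refine le_trans ?_ hlen
    rw [← hstep i]
    rw [abs_le]
    constructor <;> linarith [(ht j).1, (ht j).2, (ht l).1, (ht l).2]
  · have e : σ (t j) - σ (t l) =
        ((j : ℝ) - l) * ((σ (s (i + 1)) - σ (s i)) / k) := by
      rw [hval, hval]; ring
    rw [e, abs_mul, abs_div, Nat.abs_cast]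
    have hint : (1 : ℝ) ≤ |(j : ℝ) - l| := by
      have : (1 : ℤ) ≤ |((j : ℕ) : ℤ) - (l : ℕ)| :=
        Int.one_le_abs (sub_ne_zero.2 fun h => hjl (Fin.ext (by exact_mod_cast h)))
      exact_mod_cast this
    have : 4 * ε ≤ |σ (s (i + 1)) - σ (s i)| / k := by
      rw [le_div_iff₀ hk']; linarith
    nlinarith

theorem sum_indicator_le_one_of_disjoint {ι α : Type*} [Fintype ι] {E : ι → Set α}
    (hE : Pairwise fun i j => Disjoint (E i) (E j)) (z : α) :
    ∑ j, (E j).indicator (1 : α → ℝ) z ≤ 1 := by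
  by_cases h : ∃ i, z ∈ E i
  · obtain ⟨i, hi⟩ := h
    rw [Fintype.sum_eq_single i]
    · simp [hi]
    · intro j hj
      exact Set.indicator_of_notMem (fun hz => Set.disjoint_left.1 (hE hj) hz hi) _
  · push Not at h
    simp [h]

/-- A randomized algorithm with at most `q` expected queries cannot recognize many product
distributions that are close to each other. -/
theorem RandomizedAlgorithm.sum_recognition_le {n d₀ dₑ d₁ k : ℕ}
    (A : RandomizedAlgorithm true n d₀ dₑ d₁) (y₀ y₁ : Vec d₀) {E : Fin k → Set (Vec d₁)}
    (hEm : ∀ j, MeasurableSet (E j)) (hE : Pairwise fun i j => Disjoint (E i) (E j))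
    {p κ q : ℝ} {r : Fin k → ℝ} (hp : p ∈ Set.Ioo (0 : ℝ) 1)
    (hr : ∀ j, r j ∈ Set.Ioo (0 : ℝ) 1) (hκ : ∀ j, (r j - p) ^ 2 / (p * (1 - p)) ≤ κ)
    (hκ0 : 0 ≤ κ) (hq : 0 ≤ q)
    (hA : ∀ x, A.expectedQueries (completeInput dₑ y₀ y₁ x) ≤ ENNReal.ofReal q) :
    ∑ j, ∑ x, bernoulliWeight (fun _ => r j) x *
      A.prob.real {ω | (A.tree ω).run (completeInput dₑ y₀ y₁ x) ∈ E j} ≤ 2 + k * (κ * q) := by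
  have hW : ∀ j (x : Fin n → Bool), 0 ≤ bernoulliWeight (fun _ => r j) x := fun j =>
    bernoulliWeight_nonneg fun _ => Set.Ioo_subset_Icc_self (hr j)
  have hWp : ∀ x : Fin n → Bool, 0 ≤ bernoulliWeight (fun _ => p) x :=
    bernoulliWeight_nonneg fun _ => Set.Ioo_subset_Icc_self hp
  -- For a fixed seed the comparison terms all refer to the same law `p`, where the disjoint events
  -- have total probability at most 1. Integration over the seed follows.
  have hpt : ∀ ω, ∑ j, ∑ x, bernoulliWeight (fun _ => r j) x *
      ((E j).indicator 1 ((A.tree ω).run (completeInput dₑ y₀ y₁ x)) -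
        κ * (A.tree ω).queries (completeInput dₑ y₀ y₁ x)) ≤ 2 := by
    intro ω
    refine (Finset.sum_le_sum fun j _ =>
      DecisionTree.change_of_measure y₀ y₁ (E j) hp (hr j) (hκ j) (A.tree ω)).trans ?_
    rw [← Finset.mul_sum, Finset.sum_comm]
    simp_rw [← Finset.mul_sum]
    have : ∑ x : Fin n → Bool, bernoulliWeight (fun _ => p) x *
        ∑ j, (E j).indicator 1 ((A.tree ω).run (completeInput dₑ y₀ y₁ x)) ≤
        ∑ x : Fin n → Bool, bernoulliWeight (fun _ => p) x := Finset.sum_le_sum fun x _ =>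
      mul_le_of_le_one_right (hWp x) (sum_indicator_le_one_of_disjoint hE _)
    rw [sum_bernoulliWeight] at this
    linarith
  have hqm : ∀ x, Measurable fun ω =>
      ((A.tree ω).queries (completeInput dₑ y₀ y₁ x) : ℝ) := fun x =>
    measurable_from_top.comp (A.measurable_queries _)
  have hqe : ∀ x, ∫⁻ ω, ENNReal.ofReal ((A.tree ω).queries (completeInput dₑ y₀ y₁ x) : ℝ)
      ∂A.prob ≤ ENNReal.ofReal q := by
    intro x
    simpa [RandomizedAlgorithm.expectedQueries] using hA x
  have hqi : ∀ x, Integrable (fun ω =>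
      ((A.tree ω).queries (completeInput dₑ y₀ y₁ x) : ℝ)) A.prob := by
    intro x
    refine ⟨(hqm x).aestronglyMeasurable, ?_⟩
    rw [hasFiniteIntegral_iff_ofReal (.of_forall fun _ => Nat.cast_nonneg _)]
    exact (hqe x).trans_lt ENNReal.ofReal_lt_top
  have hqle : ∀ x, ∫ ω, ((A.tree ω).queries (completeInput dₑ y₀ y₁ x) : ℝ) ∂A.prob ≤ q := by
    intro x
    rw [integral_eq_lintegral_of_nonneg_ae (.of_forall fun _ => Nat.cast_nonneg _)
      (hqm x).aestronglyMeasurable]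
    exact ENNReal.toReal_le_of_le_ofReal hq (hqe x)
  have hmeas : ∀ j x, MeasurableSet
      {ω | (A.tree ω).run (completeInput dₑ y₀ y₁ x) ∈ E j} := fun j x =>
    A.measurable_run _ (hEm j)
  have hind : ∀ j x, (fun ω => (E j).indicator (1 : Vec d₁ → ℝ)
      ((A.tree ω).run (completeInput dₑ y₀ y₁ x))) =
      {ω | (A.tree ω).run (completeInput dₑ y₀ y₁ x) ∈ E j}.indicator 1 := fun j x => rfl
  have hii : ∀ j x, Integrable (fun ω => (E j).indicator (1 : Vec d₁ → ℝ)
      ((A.tree ω).run (completeInput dₑ y₀ y₁ x))) A.prob := by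
    intro j x
    rw [hind]
    exact (integrable_const (1 : ℝ)).indicator (hmeas j x)
  have hterm : ∀ j x, Integrable (fun ω => bernoulliWeight (fun _ => r j) x *
      ((E j).indicator (1 : Vec d₁ → ℝ) ((A.tree ω).run (completeInput dₑ y₀ y₁ x)) -
        κ * (A.tree ω).queries (completeInput dₑ y₀ y₁ x))) A.prob := fun j x =>
    ((hii j x).sub ((hqi x).const_mul κ)).const_mul _
  have hint := integral_mono (μ := A.prob)
    (integrable_finsetSum _ fun j _ => integrable_finsetSum _ fun x _ => hterm j x)
    (integrable_const (2 : ℝ)) hpt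
  rw [integral_finsetSum _ fun j _ => integrable_finsetSum _ fun x _ => hterm j x] at hint
  simp_rw [integral_finsetSum _ fun x _ => hterm _ x, integral_const_mul,
    integral_sub (hii _ _) ((hqi _).const_mul κ), hind, integral_indicator_one (hmeas _ _),
    integral_const_mul] at hint
  simp only [integral_const, probReal_univ, smul_eq_mul, one_mul] at hint
  have hle : ∑ j : Fin k, ∑ x : Fin n → Bool, bernoulliWeight (fun _ => r j) x *
      (κ * ∫ ω, ((A.tree ω).queries (completeInput dₑ y₀ y₁ x) : ℝ) ∂A.prob) ≤
      k * (κ * q) := by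
    calc _ ≤ ∑ j : Fin k, ∑ x : Fin n → Bool, bernoulliWeight (fun _ => r j) x * (κ * q) := by
          gcongr with j _ x _
          · exact hW j x
          · exact hqle x
      _ = _ := by simp [← Finset.sum_mul, sum_bernoulliWeight]
  simp only [mul_sub, Finset.sum_sub_distrib] at hint
  linarith

/-! ### GraphSAGE-GCN: hard inputs, regularity and lower bound -/

/-- The output of GraphSAGE-GCN with a parameter matrix that has a single entry `1`, in row `i₀`,
when the selected coordinate of the mean is `t`. -/
noncomputable def singleRowOutput {d : ℕ} (σ : ℝ → ℝ) (i₀ : Fin d) (t : ℝ) : Vec d :=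
  WithLp.toLp 2 fun i => σ (if i = i₀ then t else 0)

theorem norm_singleRowOutput_sub {d : ℕ} (σ : ℝ → ℝ) (i₀ : Fin d) (s t : ℝ) :
    ‖singleRowOutput σ i₀ s - singleRowOutput σ i₀ t‖ = |σ s - σ t| := by
  have : singleRowOutput σ i₀ s - singleRowOutput σ i₀ t =
      EuclideanSpace.single i₀ (σ s - σ t) := by
    ext i
    by_cases h : i = i₀ <;> simp [singleRowOutput, h]
  rw [this]
  exact (PiLp.norm_single 2 _ i₀ _).trans (Real.norm_eq_abs _)

/-- All degrees equal `n`, so the messages add up to the mean of the features; the matrix unit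
copies its coordinate `j₀` to row `i₀` and sends 0 to the other rows. -/
theorem graphSageGCN_embed_completeInput (σ : ℝ → ℝ) {n d₀ dₑ d₁ : ℕ} (i₀ : Fin d₁)
    (j₀ : Fin d₀) (α β : ℝ) (x : Fin n → Bool) (v : Fin n) :
    (graphSageGCN σ d₀ dₑ d₁).embed
      (completeInput dₑ (EuclideanSpace.single j₀ α) (EuclideanSpace.single j₀ β) x)
      (EuclideanSpace.single (i₀, j₀) 1) v =
    singleRowOutput σ i₀ ((n : ℝ)⁻¹ * ∑ u, if x u then β else α) := by
  have hdeg : (completeInput dₑ (EuclideanSpace.single j₀ α) (EuclideanSpace.single j₀ β)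
      x).deg v = n := by simp [GraphInput.deg, completeInput]
  have hsum : (List.map (fun u => (n : ℝ)⁻¹ • (if x u then EuclideanSpace.single j₀ β else
      EuclideanSpace.single j₀ α)) (List.finRange n)).sum =
      EuclideanSpace.single j₀ ((n : ℝ)⁻¹ * ∑ u, if x u then β else α) := by
    rw [← List.ofFn_eq_map, List.sum_ofFn, ← Finset.smul_sum]
    ext j
    by_cases hj : j = j₀
    · subst hj
      simp only [PiLp.smul_apply, WithLp.ofLp_sum, Finset.sum_apply, smul_eq_mul]
      simp [apply_ite (fun y : Vec d₀ => y.ofLp j)]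
    · simp only [PiLp.smul_apply, WithLp.ofLp_sum, Finset.sum_apply, smul_eq_mul]
      simp [apply_ite (fun y : Vec d₀ => y.ofLp j), hj]
  have : (graphSageGCN σ d₀ dₑ d₁).embed
      (completeInput dₑ (EuclideanSpace.single j₀ α) (EuclideanSpace.single j₀ β) x)
      (EuclideanSpace.single (i₀, j₀) 1) v = WithLp.toLp 2 fun i => σ (∑ j,
        (EuclideanSpace.single (i₀, j₀) (1 : ℝ)) (i, j) *
        (EuclideanSpace.single j₀ ((n : ℝ)⁻¹ * ∑ u, if x u then β else α) : Vec d₀) j) := by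
    rw [← hsum]
    unfold OneLayerMPNN.embed graphSageGCN
    simp only
    rw [hdeg]
    rfl
  rw [this, singleRowOutput]
  congr 1
  ext i
  congr 1
  rw [Finset.sum_eq_single j₀]
  · by_cases h : i = i₀ <;> simp [h]
  · intro j _ hj
    simp [hj]
  · simp

theorem graphSageGCN_lipschitzOnBounded {σ : ℝ → ℝ} {K : ℝ≥0} (hσ : LipschitzWith K σ)
    (d₀ dₑ d₁ : ℕ) : (graphSageGCN σ d₀ dₑ d₁).LipschitzOnBounded := by
  intro R
  -- On the ball each product `W (i, j) * h j` is `2|R|`-Lipschitz; a row has `d₀` of them, `σ`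
  -- contributes `K`, and `d₁` bounds `√d₁`. The further `1` in the witness serves `deg(i) M_{iu}`,
  -- a coordinate projection.
  set L : ℝ≥0 := d₁ * (K * (d₀ * (2 * ‖R‖₊))) with hL
  refine ⟨L + 1, ?_, ?_⟩
  · refine LipschitzOnWith.weaken (K := L) ?_ (by simp)
    refine LipschitzOnWith.of_dist_le_mul fun p hp q hq => ?_
    rw [dist_eq_norm, dist_eq_norm]
    have hR : ∀ p : Vec d₀ × Vec d₀ × EuclideanSpace ℝ (Fin d₁ × Fin d₀),
        p ∈ Metric.closedBall 0 R → ‖p.2.1‖ ≤ |R| ∧ ‖p.2.2‖ ≤ |R| := by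
      intro p hp
      have : ‖p‖ ≤ |R| := (mem_closedBall_zero_iff.1 hp).trans (le_abs_self R)
      exact ⟨((norm_fst_le p.2).trans (norm_snd_le p)).trans this,
        ((norm_snd_le p.2).trans (norm_snd_le p)).trans this⟩
    have h1 : ‖p.2.1 - q.2.1‖ ≤ ‖p - q‖ := (norm_fst_le (p - q).2).trans (norm_snd_le (p - q))
    have h2 : ‖p.2.2 - q.2.2‖ ≤ ‖p - q‖ := (norm_snd_le (p - q).2).trans (norm_snd_le (p - q))
    have hrow : ∀ i : Fin d₁, |σ (∑ j, p.2.2 (i, j) * p.2.1 j) -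
        σ (∑ j, q.2.2 (i, j) * q.2.1 j)| ≤ K * (d₀ * (2 * |R|)) * ‖p - q‖ := by
      intro i
      have := hσ.dist_le_mul (∑ j, p.2.2 (i, j) * p.2.1 j) (∑ j, q.2.2 (i, j) * q.2.1 j)
      rw [Real.dist_eq, Real.dist_eq] at this
      refine this.trans ?_
      rw [mul_assoc (K : ℝ)]
      gcongr
      rw [← Finset.sum_sub_distrib]
      refine (Finset.abs_sum_le_sum_abs _ _).trans ?_
      have hj : ∀ j ∈ (Finset.univ : Finset (Fin d₀)),
          |p.2.2 (i, j) * p.2.1 j - q.2.2 (i, j) * q.2.1 j| ≤ 2 * |R| * ‖p - q‖ := by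
        intro j _
        have e : p.2.2 (i, j) * p.2.1 j - q.2.2 (i, j) * q.2.1 j =
          (p.2.2 - q.2.2) (i, j) * p.2.1 j + q.2.2 (i, j) * (p.2.1 - q.2.1) j := by
          simp; ring
        rw [e]
        refine (abs_add_le _ _).trans ?_
        rw [abs_mul, abs_mul]
        have a1 := (PiLp.norm_apply_le (p.2.2 - q.2.2) (i, j)).trans h2
        have a2 := (PiLp.norm_apply_le p.2.1 j).trans (hR p hp).1
        have a3 := (PiLp.norm_apply_le q.2.2 (i, j)).trans (hR q hq).2
        have a4 := (PiLp.norm_apply_le (p.2.1 - q.2.1) j).trans h1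
        rw [Real.norm_eq_abs] at a1 a2 a3 a4
        have b1 := mul_le_mul a1 a2 (abs_nonneg _) (norm_nonneg _)
        have b2 := mul_le_mul a3 a4 (abs_nonneg _) (abs_nonneg _)
        linarith
      refine (Finset.sum_le_sum hj).trans (le_of_eq ?_)
      simp; ring
    refine (EuclideanSpace.norm_eq _).trans_le ?_
    refine Real.sqrt_le_iff.2 ⟨by positivity, ?_⟩
    have hM : 0 ≤ K * (d₀ * (2 * |R|)) * ‖p - q‖ := by positivity
    refine (Finset.sum_le_sum (g := fun _ => (K * (d₀ * (2 * |R|)) * ‖p - q‖) ^ 2)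
      fun i _ => ?_).trans ?_
    · rw [Real.norm_eq_abs]
      exact pow_le_pow_left₀ (abs_nonneg _) (hrow i) 2
    · have : (L : ℝ) * ‖p - q‖ = d₁ * (K * (d₀ * (2 * |R|)) * ‖p - q‖) := by
        simp [hL]; ring
      rw [this, mul_pow (d₁ : ℝ)]
      simp only [Finset.sum_const, Finset.card_univ, Fintype.card_fin, nsmul_eq_mul]
      gcongr
      exact_mod_cast Nat.le_self_pow two_ne_zero d₁
  · intro n I i u hu
    have hdeg : (I.deg i : ℝ) ≠ 0 :=
      Nat.cast_ne_zero.2 (List.length_pos_of_mem hu).ne'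
    constructor
    · have : (fun p : Vec d₀ × Vec d₀ × Vec dₑ × EuclideanSpace ℝ (Fin d₁ × Fin d₀) =>
          (I.deg i : ℝ) • (graphSageGCN σ d₀ dₑ d₁).M i u (I.deg i) (I.deg u)
            p.1 p.2.1 p.2.2.1 p.2.2.2) = fun p => p.2.1 := by
        ext1 p
        exact smul_inv_smul₀ hdeg p.2.1
      rw [this]
      refine (LipschitzWith.weaken (K := 1) ?_ (by simp)).lipschitzOnWith
      exact LipschitzWith.of_dist_le_mul fun p q => by
        rw [dist_eq_norm, dist_eq_norm, NNReal.coe_one, one_mul]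
        exact (norm_fst_le (p - q).2).trans (norm_snd_le (p - q))
    · simp only [graphSageGCN, smul_zero, norm_zero]
      positivity

/-- GraphSAGE-GCN needs `Ω(ε⁻²)` queries. -/
theorem graphSageGCN_query_lower_bound {d₀ dₑ d₁ : ℕ} {σ : ℝ → ℝ} {K : ℝ≥0} (h₀ : 0 < d₀)
    (h₁ : 0 < d₁) (hσ : LipschitzWith K σ) {a b : ℝ} (hab : a < b) (hne : σ a ≠ σ b)
    {B : ℝ} (hB : max 1 (max |2 * a - b| |2 * b - a|) ≤ B) {δ : ℝ} (hδ : δ < 1) :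
    ∃ c ε₀ : ℝ, 0 < c ∧ 0 < ε₀ ∧ ∀ ε : ℝ, 0 < ε → ε < ε₀ →
      ∀ A : (n : ℕ) → Fin n → EuclideanSpace ℝ (Fin d₁ × Fin d₀) →
          RandomizedAlgorithm (graphSageGCN σ d₀ dₑ d₁).loops n d₀ dₑ d₁,
        (graphSageGCN σ d₀ dₑ d₁).ApproximatedBy A B ε δ →
        ∃ (n : ℕ) (v : Fin n) (θ : EuclideanSpace ℝ (Fin d₁ × Fin d₀))
          (I : GraphInput (graphSageGCN σ d₀ dₑ d₁).loops n d₀ dₑ),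
          I.BoundedBy θ B ∧
          ENNReal.ofReal (c * (1 / ε ^ 2)) ≤ (A n v θ).expectedQueries I := by
  obtain ⟨k, hk⟩ := exists_nat_gt (6 / (1 - δ))
  have hδ' : 0 < 1 - δ := sub_pos.2 hδ
  have hk0 : (0 : ℝ) < k := lt_trans (by positivity) hk
  have hkpos : 0 < k := by exact_mod_cast hk0
  have hba : 0 < b - a := sub_pos.2 hab
  set D := |σ b - σ a| with hD
  have hD0 : 0 < D := abs_pos.2 (sub_ne_zero.2 hne.symm)
  -- The first constant makes `k * κ * q = 1` for `q = c / ε²` and the `κ` below; the second is the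
  -- requirement `4kε ≤ D` of the separation lemma.
  refine ⟨D ^ 2 / (32 * k ^ 3), D / (4 * k), by positivity, by positivity, ?_⟩
  intro ε hε hεε A hA
  by_contra! hcon
  obtain ⟨t, htab, htd, hts⟩ := exists_separated_values hσ.continuous hab hD.symm hkpos hε
    (by rw [lt_div_iff₀ (by positivity)] at hεε; linarith)
  set i₀ : Fin d₁ := ⟨0, h₁⟩
  set j₀ : Fin d₀ := ⟨0, h₀⟩
  -- `[a, b]` is the middle third of `[α, β]`, so the biases `r j` with mean feature `t j` lie in
  -- `[1/3, 2/3]`, away from the degenerate laws.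
  set α := 2 * a - b with hα
  set β := 2 * b - a with hβ
  have hB1 : 1 ≤ B := (le_max_left _ _).trans hB
  have hBα : |α| ≤ B := (le_max_left _ _).trans ((le_max_right _ _).trans hB)
  have hBβ : |β| ≤ B := (le_max_right _ _).trans ((le_max_right _ _).trans hB)
  set r : Fin k → ℝ := fun j => (t j - α) / (3 * (b - a)) with hr
  have hr1 : ∀ j, 1 / 3 ≤ r j := fun j => by
    simp only [hr]
    rw [le_div_iff₀ (by positivity)]
    linarith [(htab j).1]
  have hr2 : ∀ j, r j ≤ 2 / 3 := fun j => by
    simp only [hr]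
    rw [div_le_iff₀ (by positivity)]
    linarith [(htab j).2]
  have hrI : ∀ j, r j ∈ Set.Ioo (0 : ℝ) 1 := fun j =>
    ⟨by linarith [hr1 j], by linarith [hr2 j]⟩
  have hrt : ∀ j, t j = α + 3 * (b - a) * r j := fun j => by
    simp only [hr]; field_simp; ring
  -- Large enough for the variance bound in `hvar`.
  obtain ⟨n, hn⟩ := exists_nat_gt (K ^ 2 * (9 * (b - a) ^ 2) / ε ^ 2 * (2 / (1 - δ)))
  have hn0 : (0 : ℝ) < n := lt_of_le_of_lt (by positivity) hn
  have hnpos : 0 < n := by exact_mod_cast hn0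
  set θ : EuclideanSpace ℝ (Fin d₁ × Fin d₀) := EuclideanSpace.single (i₀, j₀) 1 with hθ
  set v : Fin n := ⟨0, hnpos⟩
  set I : (Fin n → Bool) → GraphInput true n d₀ dₑ :=
    completeInput dₑ (EuclideanSpace.single j₀ α) (EuclideanSpace.single j₀ β) with hI
  have hbound : ∀ x, (I x).BoundedBy θ B := by
    intro x
    refine ⟨fun i => ?_, fun i u _ => ?_, ?_⟩
    · simp only [hI, completeInput]
      split_ifs
      · simpa using hBβ
      · simpa using hBα
    · simp only [hI, completeInput, norm_zero]
      linarith
    · simpa [hθ] using hB1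
  set T : RandomizedAlgorithm true n d₀ dₑ d₁ := A n v θ with hT
  set μ : (Fin n → Bool) → ℝ := fun x => (n : ℝ)⁻¹ * ∑ u, if x u then β else α with hμ
  have herr : ∀ x, T.errorProb (I x) (singleRowOutput σ i₀ (μ x)) ε ≤ δ := by
    intro x
    have := hA n v θ (I x) (hbound x)
    rwa [hI, hθ, graphSageGCN_embed_completeInput] at this
  set E : Fin k → Set (Vec d₁) := fun j => Metric.ball (singleRowOutput σ i₀ (t j)) (2 * ε)
    with hE
  have hdisj : Pairwise fun i j => Disjoint (E i) (E j) := by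
    intro i j hij
    refine Metric.ball_disjoint_ball ?_
    rw [dist_eq_norm, norm_singleRowOutput_sub]
    linarith [hts i j hij]
  -- The square of `|r j - r i| ≤ 8kε / (3D)`, divided by `r i * (1 - r i) ≥ 2/9`.
  set κ := 32 * k ^ 2 * ε ^ 2 / D ^ 2 with hκ
  have hκj : ∀ i j, (r j - r i) ^ 2 / (r i * (1 - r i)) ≤ κ := by
    intro i j
    have h29 : 2 / 9 ≤ r i * (1 - r i) := by nlinarith [hr1 i, hr2 i]
    have hsq : (r j - r i) ^ 2 ≤ (8 * k * ε / (3 * D)) ^ 2 := by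
      rw [sq_le_sq, abs_of_pos (a := 8 * k * ε / (3 * D)) (by positivity)]
      have : r j - r i = (t j - t i) / (3 * (b - a)) := by simp only [hr]; ring
      rw [this, abs_div, abs_of_pos (a := 3 * (b - a)) (by positivity),
        div_le_iff₀ (by positivity)]
      refine (htd j i).trans (le_of_eq ?_)
      field_simp
    rw [div_le_iff₀ (by linarith)]
    have : (8 * k * ε / (3 * D)) ^ 2 = κ * (2 / 9) := by
      rw [hκ]; field_simp; ring
    have hκ0 : 0 ≤ κ := by positivity
    nlinarith
  have hup := T.sum_recognition_le (EuclideanSpace.single j₀ α) (EuclideanSpace.single j₀ β)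
    (E := E) (fun j => Metric.isOpen_ball.measurableSet) hdisj
    (κ := κ) (q := D ^ 2 / (32 * k ^ 3) * (1 / ε ^ 2)) (hrI ⟨0, hkpos⟩) hrI
    (fun j => hκj _ j) (by positivity) (by positivity)
    (fun x => (hcon n v θ (I x) (hbound x)).le)
  have hone : k * (κ * (D ^ 2 / (32 * k ^ 3) * (1 / ε ^ 2))) = 1 := by
    rw [hκ]; field_simp
  rw [hone] at hup
  -- Chebyshev's argument in pointwise form: if `σ (μ x)` is within `ε` of `σ (t j)`, an accurate
  -- output lies in `E j`; otherwise the subtracted term is at least 1 and the bound is trivial.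
  have hlow : ∀ j x, (1 - δ) - K ^ 2 / ε ^ 2 * (μ x - t j) ^ 2 ≤
      T.prob.real {ω | (T.tree ω).run (I x) ∈ E j} := by
    intro j x
    rcases lt_or_ge |σ (μ x) - σ (t j)| ε with hlt | hge
    · have hms : MeasurableSet
          {ω | ε ≤ ‖(T.tree ω).run (I x) - singleRowOutput σ i₀ (μ x)‖} :=
        measurableSet_le measurable_const ((T.measurable_run (I x)).sub_const _).norm
      have hsub : {ω | ε ≤ ‖(T.tree ω).run (I x) - singleRowOutput σ i₀ (μ x)‖}ᶜ ⊆
          {ω | (T.tree ω).run (I x) ∈ E j} := by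
        intro ω hω
        simp only [Set.mem_compl_iff, Set.mem_ofPred_eq, not_le] at hω
        simp only [hE, Set.mem_ofPred_eq, Metric.mem_ball]
        calc dist ((T.tree ω).run (I x)) (singleRowOutput σ i₀ (t j)) ≤ _ :=
              dist_triangle _ (singleRowOutput σ i₀ (μ x)) _
          _ < ε + ε := add_lt_add (by rwa [dist_eq_norm])
              (by rwa [dist_eq_norm, norm_singleRowOutput_sub])
          _ = 2 * ε := by ring
      have hc := probReal_compl_eq_one_sub (μ := T.prob) hms
      have hm := measureReal_mono (μ := T.prob) hsub
      have he := herr x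
      rw [RandomizedAlgorithm.errorProb] at he
      have : 0 ≤ K ^ 2 / ε ^ 2 * (μ x - t j) ^ 2 := by positivity
      linarith
    · have h1 : ε ≤ K * |μ x - t j| := by
        have := hσ.dist_le_mul (μ x) (t j)
        rw [Real.dist_eq, Real.dist_eq] at this
        exact hge.trans this
      have h2 : 1 ≤ K ^ 2 / ε ^ 2 * (μ x - t j) ^ 2 := by
        rw [div_mul_eq_mul_div, one_le_div (by positivity), ← sq_abs (μ x - t j), ← mul_pow]
        exact pow_le_pow_left₀ hε.le h1 2
      have h3 : 0 ≤ T.prob.real {ω | (T.tree ω).run (I x) ∈ E j} := measureReal_nonneg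
      have hδ0 : 0 ≤ δ := measureReal_nonneg.trans (herr x)
      linarith
  have hmean : ∀ j x, μ x - t j =
      3 * (b - a) / n * ∑ u, ((if x u then 1 else 0) - r j) := by
    intro j x
    have : ∀ u, (if x u then β else α) = α + 3 * (b - a) * (if x u then 1 else 0) := by
      intro u
      split_ifs
      · rw [hα, hβ]; ring
      · ring
    simp only [hμ, this, hrt j, Finset.sum_add_distrib, Finset.sum_sub_distrib,
      ← Finset.mul_sum, Finset.sum_const, Finset.card_univ, Fintype.card_fin, nsmul_eq_mul]
    field_simp
    ring
  have hj : ∀ j, (1 - δ) / 2 ≤ ∑ x, bernoulliWeight (fun _ => r j) x *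
      T.prob.real {ω | (T.tree ω).run (I x) ∈ E j} := by
    intro j
    have hvar : ∑ x : Fin n → Bool, bernoulliWeight (fun _ => r j) x *
        (K ^ 2 / ε ^ 2 * (μ x - t j) ^ 2) ≤ (1 - δ) / 2 := by
      have e : ∀ x : Fin n → Bool, bernoulliWeight (fun _ => r j) x *
          (K ^ 2 / ε ^ 2 * (μ x - t j) ^ 2) = K ^ 2 / ε ^ 2 * (3 * (b - a) / n) ^ 2 *
          (bernoulliWeight (fun _ => r j) x * (∑ u, ((if x u then 1 else 0) - r j)) ^ 2) := by
        intro x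
        rw [hmean]; ring
      simp_rw [e]
      rw [← Finset.mul_sum, sum_bernoulliWeight_sq, Fintype.card_fin]
      have hr1' : r j * (1 - r j) ≤ 1 := by nlinarith [(hrI j).1, (hrI j).2]
      calc K ^ 2 / ε ^ 2 * (3 * (b - a) / n) ^ 2 * (n * (r j * (1 - r j)))
          ≤ K ^ 2 / ε ^ 2 * (3 * (b - a) / n) ^ 2 * (n * 1) := by gcongr
        _ = K ^ 2 * (9 * (b - a) ^ 2) / ε ^ 2 / n := by field_simp; ring
        _ ≤ (1 - δ) / 2 := by
          rw [div_le_iff₀ hn0]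
          rw [← div_div_eq_mul_div, div_div_eq_mul_div, mul_div_assoc', div_lt_iff₀ hδ'] at hn
          linarith
    have hsum : ∑ x, bernoulliWeight (fun _ => r j) x *
        ((1 - δ) - K ^ 2 / ε ^ 2 * (μ x - t j) ^ 2) ≤
        ∑ x, bernoulliWeight (fun _ => r j) x *
          T.prob.real {ω | (T.tree ω).run (I x) ∈ E j} :=
      Finset.sum_le_sum fun x _ => mul_le_mul_of_nonneg_left (hlow j x)
        (bernoulliWeight_nonneg (fun _ => Set.Ioo_subset_Icc_self (hrI j)) x)
    simp only [mul_sub _ (1 - δ), Finset.sum_sub_distrib, ← Finset.sum_mul,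
      sum_bernoulliWeight] at hsum
    linarith
  have htot := Finset.sum_le_sum (s := Finset.univ) fun j _ => hj j
  simp only [Finset.sum_const, Finset.card_univ, Fintype.card_fin, nsmul_eq_mul] at htot
  rw [div_lt_iff₀ hδ'] at hk
  linarith

/-! ### Hoeffding inequalities for independent samples -/

section Hoeffding

variable {Ω : Type*} [MeasurableSpace Ω] {ν : Measure Ω} [IsProbabilityMeasure ν]

/-- One-sided Hoeffding inequality for a sum of independent copies of a bounded function. -/
theorem measureReal_pi_sum_ge_le {f : Ω → ℝ} (hf : Measurable f) {c s : ℝ} (hc : 0 ≤ c)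
    (hfc : ∀ y, |f y| ≤ c) (hs : 0 ≤ s) (r : ℕ) :
    (Measure.pi fun _ : Fin r => ν).real {ω | s ≤ ∑ k, (f (ω k) - ∫ y, f y ∂ν)} ≤
      Real.exp (-s ^ 2 / (2 * (r * c ^ 2))) := by
  have hind : ProbabilityTheory.iIndepFun
      (fun (k : Fin r) (ω : Fin r → Ω) => f (ω k) - ∫ y, f y ∂ν)
      (Measure.pi fun _ : Fin r => ν) :=
    ProbabilityTheory.iIndepFun_pi (X := fun _ y => f y - ∫ y, f y ∂ν)
      fun _ => (hf.sub_const _).aemeasurable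
  have hsub : ∀ k ∈ (Finset.univ : Finset (Fin r)), ProbabilityTheory.HasSubgaussianMGF
      (fun ω : Fin r → Ω => f (ω k) - ∫ y, f y ∂ν) ((‖c - -c‖₊ / 2) ^ 2)
      (Measure.pi fun _ : Fin r => ν) := by
    intro k _
    have := ProbabilityTheory.hasSubgaussianMGF_of_mem_Icc (X := fun ω : Fin r → Ω => f (ω k))
      (μ := Measure.pi fun _ : Fin r => ν) (a := -c) (b := c)
      (hf.comp (measurable_pi_apply k)).aemeasurable
      (.of_forall fun ω => abs_le.1 (hfc (ω k)))
    rwa [integral_comp_eval (μ := fun _ : Fin r => ν) hf.aestronglyMeasurable] at this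
  have := ProbabilityTheory.HasSubgaussianMGF.measure_sum_ge_le_of_iIndepFun hind hsub hs
  refine this.trans (le_of_eq ?_)
  have hcc : (((‖c - -c‖₊ / 2) ^ 2 : ℝ≥0) : ℝ) = c ^ 2 := by
    push_cast
    rw [Real.norm_eq_abs, sub_neg_eq_add, abs_of_nonneg (by linarith)]
    ring
  rw [NNReal.coe_sum]
  simp only [hcc, Finset.sum_const, Finset.card_univ, Fintype.card_fin, nsmul_eq_mul]

theorem measureReal_pi_abs_sum_ge_le {f : Ω → ℝ} (hf : Measurable f) {c s : ℝ} (hc : 0 ≤ c)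
    (hfc : ∀ y, |f y| ≤ c) (hs : 0 ≤ s) (r : ℕ) :
    (Measure.pi fun _ : Fin r => ν).real {ω | s ≤ |∑ k, (f (ω k) - ∫ y, f y ∂ν)|} ≤
      2 * Real.exp (-s ^ 2 / (2 * (r * c ^ 2))) := by
  have h1 := measureReal_pi_sum_ge_le (ν := ν) hf hc hfc hs r
  have h2 := measureReal_pi_sum_ge_le (ν := ν) hf.neg hc (fun y => by simpa using hfc y) hs r
  rw [two_mul]
  refine le_trans ?_ (add_le_add h1 h2)
  refine le_trans (measureReal_mono ?_) (measureReal_union_le _ _)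
  intro ω hω
  rcases le_abs.1 (show s ≤ |∑ k, (f (ω k) - ∫ y, f y ∂ν)| from hω) with h | h
  · exact Or.inl h
  · refine Or.inr (show s ≤ ∑ k, ((-f) (ω k) - ∫ y, (-f) y ∂ν) from h.trans (le_of_eq ?_))
    rw [← Finset.sum_neg_distrib]
    refine Finset.sum_congr rfl fun k _ => ?_
    simp only [Pi.neg_apply, integral_neg]
    ring

/-- Hoeffding inequality for the mean of independent bounded random vectors. -/
theorem measureReal_pi_norm_mean_sub_ge_le {d : ℕ} {Z : Ω → Vec d} (hZ : Measurable Z) {c τ : ℝ}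
    (hc : 0 < c) (hZc : ∀ y, ‖Z y‖ ≤ c) {m : Vec d} (hm : ∀ i, ∫ y, Z y i ∂ν = m i)
    (hτ : 0 < τ) {r : ℕ} (hr : 0 < r) :
    (Measure.pi fun _ : Fin r => ν).real {ω | τ ≤ ‖(r : ℝ)⁻¹ • ∑ k, Z (ω k) - m‖} ≤
      2 * (d + 1) * Real.exp (-(r * τ ^ 2 / (2 * c ^ 2 * (d + 1) ^ 2))) := by
  have hr0 : (0 : ℝ) < r := Nat.cast_pos.2 hr
  have hZi : ∀ i, Measurable fun y => Z y i := fun i =>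
    (EuclideanSpace.proj (𝕜 := ℝ) i).measurable.comp hZ
  -- If every coordinate of the mean is off by at most `τ / (d + 1)`, the norm is at most `d τ / (d
  -- + 1) < τ`; `d + 1` also covers `d = 0`.
  set s : ℝ := r * (τ / (d + 1)) with hs
  have hcoord : ∀ i : Fin d, (Measure.pi fun _ : Fin r => ν).real
      {ω | s ≤ |∑ k, (Z (ω k) i - ∫ y, Z y i ∂ν)|} ≤
      2 * Real.exp (-s ^ 2 / (2 * (r * c ^ 2))) := fun i =>
    measureReal_pi_abs_sum_ge_le (hZi i) hc.le
      (fun y => (PiLp.norm_apply_le (Z y) i).trans (hZc y)) (by positivity) r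
  have hsub : {ω : Fin r → Ω | τ ≤ ‖(r : ℝ)⁻¹ • ∑ k, Z (ω k) - m‖} ⊆
      ⋃ i ∈ (Finset.univ : Finset (Fin d)), {ω | s ≤ |∑ k, (Z (ω k) i - ∫ y, Z y i ∂ν)|} := by
    intro ω hω
    by_contra hcon
    simp only [Set.mem_iUnion, Finset.mem_univ, exists_prop, true_and, not_exists] at hcon
    have hlt : ∀ i, |((r : ℝ)⁻¹ • ∑ k, Z (ω k) - m) i| ≤ τ / (d + 1) := by
      intro i
      have h : |∑ k, (Z (ω k) i - ∫ y, Z y i ∂ν)| < s := not_le.1 (hcon i)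
      have e : ((r : ℝ)⁻¹ • ∑ k, Z (ω k) - m) i =
          (r : ℝ)⁻¹ * ∑ k, (Z (ω k) i - ∫ y, Z y i ∂ν) := by
        rw [hm]
        simp only [PiLp.sub_apply, PiLp.smul_apply, WithLp.ofLp_sum, Finset.sum_apply,
          smul_eq_mul, Finset.sum_sub_distrib, Finset.sum_const, Finset.card_univ,
          Fintype.card_fin, nsmul_eq_mul]
        field_simp
      rw [e, abs_mul, abs_of_pos (inv_pos.2 hr0), inv_mul_le_iff₀ hr0]
      exact h.le
    have hn : ‖(r : ℝ)⁻¹ • ∑ k, Z (ω k) - m‖ ≤ d * (τ / (d + 1)) := by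
      refine (EuclideanSpace.norm_eq _).trans_le ?_
      refine Real.sqrt_le_iff.2 ⟨by positivity, ?_⟩
      refine (Finset.sum_le_sum (g := fun _ => (τ / (d + 1)) ^ 2) fun i _ =>
        pow_le_pow_left₀ (norm_nonneg _) (hlt i) 2).trans ?_
      rw [mul_pow]
      simp only [Finset.sum_const, Finset.card_univ, Fintype.card_fin, nsmul_eq_mul]
      gcongr
      exact_mod_cast Nat.le_self_pow two_ne_zero d
    have hω' : τ ≤ ‖(r : ℝ)⁻¹ • ∑ k, Z (ω k) - m‖ := hω
    have : d * (τ / (d + 1)) < τ := by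
      rw [mul_div_assoc', div_lt_iff₀ (by positivity)]
      nlinarith
    linarith
  refine (measureReal_mono hsub (measure_ne_top _ _)).trans ((measureReal_biUnion_finset_le _ _).trans ?_)
  refine (Finset.sum_le_sum fun i _ => hcoord i).trans ?_
  simp only [Finset.sum_const, Finset.card_univ, Fintype.card_fin, nsmul_eq_mul]
  have e : -s ^ 2 / (2 * (r * c ^ 2)) = -(r * τ ^ 2 / (2 * c ^ 2 * (d + 1) ^ 2)) := by
    rw [hs]; field_simp
  rw [e]
  nlinarith [Real.exp_pos (-(r * τ ^ 2 / (2 * c ^ 2 * (d + 1) ^ 2)))]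

end Hoeffding

/-! ### Analysis of neighbor sampling -/

namespace OneLayerMPNN

variable {d₀ dₑ dₕ d₁ : ℕ} {P : Type} [Fintype P]

/-- The message that `v` receives from its `i`-th neighbour, and `0` if there is none. -/
noncomputable def message (N : OneLayerMPNN d₀ dₑ dₕ d₁ P) {n : ℕ}
    (I : GraphInput N.loops n d₀ dₑ) (θ : EuclideanSpace ℝ P) (v : Fin n) (i : ℕ) : Vec dₕ :=
  ((I.nbrs v)[i]?).elim 0 fun u =>
    N.M v u (I.deg v) (I.deg u) (I.feature v) (I.feature u) (I.edge v u) θ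

theorem run_sampleLoop (N : OneLayerMPNN d₀ dₑ dₕ d₁ P) {n : ℕ}
    (I : GraphInput N.loops n d₀ dₑ) (θ : EuclideanSpace ℝ P) (v : Fin n)
    (finish : Vec dₕ → DecisionTree n d₀ dₑ d₁) (is : List ℕ) (acc : Vec dₕ) :
    (N.sampleLoop v θ (I.deg v) (I.feature v) finish is acc).run I =
      (finish (acc + (is.map (N.message I θ v)).sum)).run I := by
  induction is generalizing acc with
  | nil => simp [sampleLoop]
  | cons i is ih =>
    simp only [sampleLoop, DecisionTree.run]
    rcases h : (I.nbrs v)[i]? with _ | u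
    · have ho : I.oracle (.nbr v i) = none := by simp [GraphInput.oracle, h]; rfl
      rw [ho]
      simp only
      rw [ih]
      simp [message, h]
    · have ho : I.oracle (.nbr v i) = some (u, I.edge v u) := by
        simp [GraphInput.oracle, h]; rfl
      rw [ho]
      refine (ih (acc + N.M v u (I.deg v) (I.deg u) (I.feature v) (I.feature u)
        (I.edge v u) θ)).trans ?_
      simp [message, h, add_assoc]

theorem queries_sampleLoop_le (N : OneLayerMPNN d₀ dₑ dₕ d₁ P) {n : ℕ}
    (I : GraphInput N.loops n d₀ dₑ) (θ : EuclideanSpace ℝ P) (v : Fin n) (dv : ℕ) (xv : Vec d₀)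
    (finish : Vec dₕ → Vec d₁) (is : List ℕ) (acc : Vec dₕ) :
    (N.sampleLoop v θ dv xv (fun acc => .ret (finish acc)) is acc).queries I ≤
      3 * is.length := by
  induction is generalizing acc with
  | nil => simp [sampleLoop, DecisionTree.queries]
  | cons i is ih =>
    simp only [sampleLoop, DecisionTree.queries, List.length_cons]
    rcases I.oracle (.nbr v i) with _ | ⟨u, e⟩
    · have := ih acc
      simp only
      omega
    · have := ih (acc + N.M v u dv (I.oracle (.deg u)) xv (I.oracle (.feature u)) e θ)
      exact (Nat.succ_le_succ (Nat.succ_le_succ (Nat.succ_le_succ this))).trans (by omega)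

/-- Each sample costs at most a neighbour, a feature and a degree query; the degree and the feature
of the centre add 2. -/
theorem queries_neighborSampling_le (N : OneLayerMPNN d₀ dₑ dₕ d₁ P) (r : ℕ) {n : ℕ}
    (v : Fin n) (θ : EuclideanSpace ℝ P) (I : GraphInput N.loops n d₀ dₑ)
    (ω : (N.neighborSampling r n v θ).Ω) :
    ((N.neighborSampling r n v θ).tree ω).queries I ≤ 3 * r + 2 := by
  simp only [neighborSampling, DecisionTree.queries]
  have := N.queries_sampleLoop_le I θ v (I.oracle (.deg v)) (I.oracle (.feature v))
    (fun acc => N.U (I.oracle (.feature v)) (((I.deg v : ℝ) / (r : ℝ)) • acc) θ)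
    (List.ofFn fun k => if hd : I.deg v - 1 < n then (ω k ⟨I.deg v - 1, hd⟩ : ℕ) else 0) 0
  rw [List.length_ofFn] at this
  exact Nat.succ_le_succ (Nat.succ_le_succ this)

theorem run_neighborSampling (N : OneLayerMPNN d₀ dₑ dₕ d₁ P) (r : ℕ) {n : ℕ}
    (v : Fin n) (θ : EuclideanSpace ℝ P) (I : GraphInput N.loops n d₀ dₑ)
    (hd : I.deg v - 1 < n) (ω : Fin r → (m : Fin n) → Fin (m + 1)) :
    ((N.neighborSampling r n v θ).tree ω).run I =
      N.U (I.feature v) (((I.deg v : ℝ) / (r : ℝ)) •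
        ∑ k, N.message I θ v (ω k ⟨I.deg v - 1, hd⟩)) θ := by
  have := N.run_sampleLoop I θ v
    (fun acc => .ret (N.U (I.feature v) (((I.deg v : ℝ) / (r : ℝ)) • acc) θ))
    (List.ofFn fun k => if hd : I.deg v - 1 < n then (ω k ⟨I.deg v - 1, hd⟩ : ℕ) else 0) 0
  rw [DecisionTree.run, zero_add, List.map_ofFn, List.sum_ofFn] at this
  refine Eq.trans ?_ (this.trans ?_)
  · rfl
  · simp [hd]

theorem embed_eq_sum_message (N : OneLayerMPNN d₀ dₑ dₕ d₁ P) {n : ℕ}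
    (I : GraphInput N.loops n d₀ dₑ) (θ : EuclideanSpace ℝ P) (v : Fin n) :
    N.embed I θ v = N.U (I.feature v) (∑ i : Fin (I.deg v), N.message I θ v i) θ := by
  rw [embed]
  congr 1
  rw [← List.sum_ofFn]
  congr 1
  refine List.ext_getElem (by simp [GraphInput.deg]) fun i h1 h2 => ?_
  simp only [List.length_map] at h1
  simp [message, List.getElem?_eq_getElem h1]

/-- The Lipschitz bound compares with the origin, where the value is at most `K`. In the maximum
norm of the product, the tuple of arguments has norm at most `B`. -/
theorem norm_deg_smul_message_le (N : OneLayerMPNN d₀ dₑ dₕ d₁ P) {K : ℝ≥0} {B : ℝ}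
    (hK : ∀ (n : ℕ) (I : GraphInput N.loops n d₀ dₑ) (i u : Fin n), u ∈ I.nbrs i →
      LipschitzOnWith K
        (fun p : Vec d₀ × Vec d₀ × Vec dₑ × EuclideanSpace ℝ P =>
          (I.deg i : ℝ) • N.M i u (I.deg i) (I.deg u) p.1 p.2.1 p.2.2.1 p.2.2.2)
        (Metric.closedBall 0 B) ∧
      ‖(I.deg i : ℝ) • N.M i u (I.deg i) (I.deg u) 0 0 0 0‖ ≤ K)
    {n : ℕ} (I : GraphInput N.loops n d₀ dₑ) (θ : EuclideanSpace ℝ P) (hI : I.BoundedBy θ B)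
    (v : Fin n) (i : ℕ) : ‖(I.deg v : ℝ) • N.message I θ v i‖ ≤ K * B + K := by
  have hB : 0 ≤ B := (norm_nonneg θ).trans hI.2.2
  rcases h : (I.nbrs v)[i]? with _ | u
  · simp only [message, h, Option.elim_none, smul_zero, norm_zero]
    positivity
  · have hu : u ∈ I.nbrs v := List.mem_of_getElem? h
    obtain ⟨hL, h0⟩ := hK n I v u hu
    simp only [message, h, Option.elim_some]
    set p : Vec d₀ × Vec d₀ × Vec dₑ × EuclideanSpace ℝ P :=
      (I.feature v, I.feature u, I.edge v u, θ) with hp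
    have hpB : ‖p‖ ≤ B := by
      simp only [hp, norm_prod_le_iff]
      exact ⟨hI.1 v, hI.1 u, hI.2.1 v u hu, hI.2.2⟩
    have := hL.dist_le_mul p (mem_closedBall_zero_iff.2 hpB) 0
      (mem_closedBall_zero_iff.2 (by simpa using hB))
    rw [dist_eq_norm, dist_zero_right] at this
    refine (norm_le_norm_sub_add _ _).trans (add_le_add (this.trans ?_) h0)
    gcongr

/-- The sample mean and `h_v` are both averages of vectors of norm at most `c ≤ R`, so the Lipschitz
bound of `U` on the ball applies to them. Dividing by `K + 1` instead of `K` allows `K = 0`. -/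
theorem errorProb_neighborSampling_le (N : OneLayerMPNN d₀ dₑ dₕ d₁ P) {n : ℕ}
    (I : GraphInput N.loops n d₀ dₑ) (θ : EuclideanSpace ℝ P) (v : Fin n) {c R ε : ℝ}
    {K : ℝ≥0} (hc : 0 < c) (hm : ∀ i, ‖(I.deg v : ℝ) • N.message I θ v i‖ ≤ c)
    (hU : LipschitzOnWith K
      (fun p : Vec d₀ × Vec dₕ × EuclideanSpace ℝ P => N.U p.1 p.2.1 p.2.2)
      (Metric.closedBall 0 R))
    (hv : ‖I.feature v‖ ≤ R) (hcR : c ≤ R) (hθ : ‖θ‖ ≤ R) (hε : 0 < ε) {r : ℕ} (hr : 0 < r) :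
    (N.neighborSampling r n v θ).errorProb I (N.embed I θ v) ε ≤
      2 * (dₕ + 1) *
        Real.exp (-(r * (ε / (K + 1)) ^ 2 / (2 * c ^ 2 * (dₕ + 1) ^ 2))) := by
  have hr0 : (0 : ℝ) < r := Nat.cast_pos.2 hr
  have hdn : I.deg v ≤ n := by
    have := (I.nodup_nbrs v).length_le_card
    rwa [Fintype.card_fin] at this
  have hd : I.deg v - 1 < n := by have := v.2; omega
  change (Measure.pi fun _ => Measure.pi fun m : Fin n =>
    (PMF.uniformOfFintype (Fin (m + 1))).toMeasure).real
      {ω : Fin r → (m : Fin n) → Fin (m + 1) |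
        ε ≤ ‖((N.neighborSampling r n v θ).tree ω).run I - N.embed I θ v‖} ≤ _
  simp_rw [run_neighborSampling N r v θ I hd, embed_eq_sum_message]
  -- At an isolated node both aggregates are 0 and the estimate is exact.
  rcases Nat.eq_zero_or_pos (I.deg v) with h0 | hpos
  · have hempty : ∑ i : Fin (I.deg v), N.message I θ v i = 0 := by
      rw [h0]; simp
    rw [hempty]
    simp only [h0, Nat.cast_zero, zero_div, zero_smul, sub_self, norm_zero, not_le.2 hε]
    simp only [Set.ofPred_false, measureReal_empty]
    positivity
  have hd0 : (0 : ℝ) < I.deg v := Nat.cast_pos.2 hpos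
  set m₀ : Fin n := ⟨I.deg v - 1, hd⟩ with hm₀
  set Z : ((m : Fin n) → Fin (m + 1)) → Vec dₕ :=
    fun y => (I.deg v : ℝ) • N.message I θ v (y m₀) with hZ
  set h : Vec dₕ := ∑ i : Fin (I.deg v), N.message I θ v i with hh
  have hmean : ∀ i, ∫ y, Z y i ∂(Measure.pi fun m : Fin n =>
      (PMF.uniformOfFintype (Fin (m + 1))).toMeasure) = h i := by
    intro i
    have h1 := integral_comp_eval (μ := fun m : Fin n =>
      (PMF.uniformOfFintype (Fin (m + 1))).toMeasure) (i := m₀)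
      (f := fun j : Fin (m₀ + 1) => ((I.deg v : ℝ) • N.message I θ v j) i)
      (Measurable.of_discrete).aestronglyMeasurable
    refine h1.trans ?_
    rw [PMF.integral_eq_sum]
    have hcard : (m₀ : ℕ) + 1 = I.deg v := by simp only [hm₀]; omega
    -- The size of the index type is generalized so that `m₀ + 1 = deg(v)` can be substituted.
    have h2 : ∀ (q : ℕ), q = I.deg v → ∑ j : Fin q, (q : ℝ)⁻¹ •
        ((I.deg v : ℝ) • N.message I θ v j) i = h i := by
      rintro q rfl
      simp only [hh, WithLp.ofLp_sum, Finset.sum_apply, PiLp.smul_apply, smul_eq_mul]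
      refine Finset.sum_congr rfl fun j _ => ?_
      field_simp
    rw [← h2 _ hcard]
    refine Finset.sum_congr rfl fun j _ => ?_
    simp only [PMF.uniformOfFintype_apply, Fintype.card_fin, ENNReal.toReal_inv,
      ENNReal.toReal_natCast]
  have hsum : ∀ ω : Fin r → (m : Fin n) → Fin (m + 1),
      ((I.deg v : ℝ) / r) • ∑ k, N.message I θ v (ω k m₀) = (r : ℝ)⁻¹ • ∑ k, Z (ω k) := by
    intro ω
    simp only [hZ, ← Finset.smul_sum, smul_smul]
    congr 1
    ring
  have hhc : ‖h‖ ≤ c := by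
    have e : h = (I.deg v : ℝ)⁻¹ • ∑ i : Fin (I.deg v), (I.deg v : ℝ) • N.message I θ v i := by
      rw [← Finset.smul_sum, smul_smul, inv_mul_cancel₀ hd0.ne', one_smul]
    rw [e, norm_smul, norm_inv, Real.norm_eq_abs, abs_of_pos hd0, inv_mul_le_iff₀ hd0]
    refine (norm_sum_le _ _).trans ((Finset.sum_le_sum fun (i : Fin (I.deg v)) _ => hm i).trans (le_of_eq ?_))
    simp
  have hZc : ∀ ω : Fin r → (m : Fin n) → Fin (m + 1), ‖(r : ℝ)⁻¹ • ∑ k, Z (ω k)‖ ≤ c := by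
    intro ω
    rw [norm_smul, norm_inv, Real.norm_eq_abs, abs_of_pos hr0, inv_mul_le_iff₀ hr0]
    refine (norm_sum_le _ _).trans ((Finset.sum_le_sum fun i _ => hm _).trans (le_of_eq ?_))
    simp
  refine le_trans (measureReal_mono ?_) (measureReal_pi_norm_mean_sub_ge_le
    (Measurable.of_discrete (f := Z)) hc (fun y => hm _) hmean
    (show 0 < ε / (K + 1) by positivity) hr)
  intro ω hω
  have hω' : ε ≤ ‖N.U (I.feature v) (((I.deg v : ℝ) / r) •
      ∑ k, N.message I θ v (ω k m₀)) θ - N.U (I.feature v) h θ‖ := hω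
  rw [hsum] at hω'
  have hball : ∀ g : Vec dₕ, ‖g‖ ≤ c →
      ((I.feature v, g, θ) : Vec d₀ × Vec dₕ × EuclideanSpace ℝ P) ∈
        Metric.closedBall 0 R := by
    intro g hg
    rw [mem_closedBall_zero_iff]
    simp only [norm_prod_le_iff]
    exact ⟨hv, hg.trans hcR, hθ⟩
  have hLip := hU.dist_le_mul _ (hball _ (hZc ω)) _ (hball _ hhc)
  rw [dist_eq_norm, dist_eq_norm] at hLip
  have hn : ‖((I.feature v, (r : ℝ)⁻¹ • ∑ k, Z (ω k), θ) :
      Vec d₀ × Vec dₕ × EuclideanSpace ℝ P) - (I.feature v, h, θ)‖ =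
      ‖(r : ℝ)⁻¹ • ∑ k, Z (ω k) - h‖ := by
    simp [Prod.norm_def]
  rw [hn] at hLip
  change ε / (K + 1) ≤ ‖(r : ℝ)⁻¹ • ∑ k, Z (ω k) - h‖
  rw [div_le_iff₀ (by positivity)]
  nlinarith [norm_nonneg ((r : ℝ)⁻¹ • ∑ k, Z (ω k) - h)]

/-- Neighbor sampling approximates one-layer models with `O(ε⁻² log (1 / δ))` queries. -/
theorem exists_neighborSampling_approximatedBy (N : OneLayerMPNN d₀ dₑ dₕ d₁ P)
    (hN : N.LipschitzOnBounded) (B : ℝ) : ∃ C : ℝ, 0 < C ∧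
      ∀ ε δ : ℝ, 0 < ε → ε ≤ 1 → 0 < δ → δ ≤ 1 / 2 → ∃ r : ℕ, 0 < r ∧
        N.ApproximatedBy (N.neighborSampling r) B ε δ ∧
        ∀ (n : ℕ) (v : Fin n) (θ : EuclideanSpace ℝ P) (I : GraphInput N.loops n d₀ dₑ)
          (ω : (N.neighborSampling r n v θ).Ω),
          ((((N.neighborSampling r n v θ).tree ω).queries I : ℕ) : ℝ)
            ≤ C * (1 / ε ^ 2 * Real.log (1 / δ)) := by
  obtain ⟨K₁, -, hK₁⟩ := hN B
  -- A bound for the rescaled messages, positive even for negative `B`. It has to be fixed before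
  -- the radius on which `U` is controlled.
  set c : ℝ := K₁ * |B| + K₁ + 1 with hc
  have hc0 : 0 < c := by positivity
  obtain ⟨K₂, hK₂, -⟩ := hN (max B c)
  set G : ℝ := 2 * c ^ 2 * (dₕ + 1) ^ 2 * (K₂ + 1) ^ 2 with hG
  have hG0 : 0 < G := by positivity
  have hl2 : 0 < Real.log 2 := Real.log_pos one_lt_two
  -- Since `log (1/δ) ≥ log 2`, the factor `H` absorbs the prefactor `2(dₕ + 1)` of the tail bound.
  set H : ℝ := Real.log (2 * (dₕ + 1)) / Real.log 2 + 1 with hH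
  have hlog : 0 ≤ Real.log (2 * (dₕ + 1)) := Real.log_nonneg (by linarith [dₕ.cast_nonneg (α := ℝ)])
  have hH0 : 0 < H := by positivity
  -- Rounding up `r` gives at most `3GHX + 5` queries with `X = ε⁻² log (1/δ)`, and `X ≥ log 2`
  -- turns 5 into a multiple of `X`.
  refine ⟨3 * (G * H) + 5 / Real.log 2, by positivity, ?_⟩
  intro ε δ hε hε1 hδ hδ1
  have hℓ2 : Real.log 2 ≤ Real.log (1 / δ) := by
    refine Real.log_le_log two_pos ?_
    rw [le_div_iff₀ hδ]; linarith
  set ℓ := Real.log (1 / δ) with hℓ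
  have hℓ0 : 0 < ℓ := hl2.trans_le hℓ2
  set r := ⌈G * H * (1 / ε ^ 2 * ℓ)⌉₊ with hr
  have hr1 : G * H * (1 / ε ^ 2 * ℓ) ≤ r := Nat.le_ceil _
  have hr0 : 0 < r := Nat.ceil_pos.2 (by positivity)
  refine ⟨r, hr0, ?_, ?_⟩
  · intro n v θ I hI
    have hB : 0 ≤ B := (norm_nonneg θ).trans hI.2.2
    refine (N.errorProb_neighborSampling_le I θ v hc0 (fun i => ?_) hK₂
      ((hI.1 v).trans (le_max_left _ _)) (le_max_right _ _) (hI.2.2.trans (le_max_left _ _))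
      hε hr0).trans ?_
    · refine (N.norm_deg_smul_message_le hK₁ I θ hI v i).trans ?_
      rw [hc, abs_of_nonneg hB]
      linarith
    · have e : r * (ε / (K₂ + 1)) ^ 2 / (2 * c ^ 2 * (dₕ + 1) ^ 2) = r * ε ^ 2 / G := by
        rw [hG]; field_simp
      have h1 : Real.log (2 * (dₕ + 1)) + ℓ ≤ r * ε ^ 2 / G := by
        have h2 : H * ℓ ≤ r * ε ^ 2 / G := by
          rw [le_div_iff₀ hG0]
          calc H * ℓ * G = G * H * (1 / ε ^ 2 * ℓ) * ε ^ 2 := by field_simp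
            _ ≤ r * ε ^ 2 := by gcongr
        have h3 : Real.log (2 * (dₕ + 1)) ≤ Real.log (2 * (dₕ + 1)) / Real.log 2 * ℓ := by
          rw [div_mul_eq_mul_div, le_div_iff₀ hl2]
          gcongr
        rw [hH] at h2
        linarith
      rw [e]
      calc 2 * (dₕ + 1) * Real.exp (-(r * ε ^ 2 / G))
          ≤ 2 * (dₕ + 1) * Real.exp (-(Real.log (2 * (dₕ + 1)) + ℓ)) := by gcongr
        _ = δ := by
          rw [neg_add, Real.exp_add, Real.exp_neg, Real.exp_log (by positivity), hℓ,
            Real.exp_neg, Real.exp_log (by positivity)]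
          field_simp
  · intro n v θ I ω
    have h1 : (((N.neighborSampling r n v θ).tree ω).queries I : ℝ) ≤ 3 * r + 2 := by
      exact_mod_cast N.queries_neighborSampling_le r v θ I ω
    have h2 : (r : ℝ) < G * H * (1 / ε ^ 2 * ℓ) + 1 := Nat.ceil_lt_add_one (by positivity)
    have h3 : 1 ≤ 1 / Real.log 2 * (1 / ε ^ 2 * ℓ) := by
      have h4 : 1 ≤ 1 / ε ^ 2 := by
        rw [le_div_iff₀ (by positivity)]
        nlinarith
      calc (1 : ℝ) = 1 / Real.log 2 * (1 * Real.log 2) := by field_simp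
        _ ≤ _ := by gcongr
    have : (3 * (G * H) + 5 / Real.log 2) * (1 / ε ^ 2 * ℓ) =
        3 * (G * H * (1 / ε ^ 2 * ℓ)) + 5 * (1 / Real.log 2 * (1 / ε ^ 2 * ℓ)) := by ring
    rw [this]
    linarith

end OneLayerMPNN

theorem theorem3 :
    -- upper bound: neighbor sampling on one-layer models
    (∀ (d₀ dₑ dₕ d₁ : ℕ) (P : Type) [Fintype P] (N : OneLayerMPNN d₀ dₑ dₕ d₁ P),
      N.LipschitzOnBounded → ∀ B : ℝ, ∃ C : ℝ, 0 < C ∧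
        ∀ ε δ : ℝ, 0 < ε → ε ≤ 1 → 0 < δ → δ ≤ 1 / 2 → ∃ r : ℕ, 0 < r ∧
          N.ApproximatedBy (N.neighborSampling r) B ε δ ∧
          ∀ (n : ℕ) (v : Fin n) (θ : EuclideanSpace ℝ P) (I : GraphInput N.loops n d₀ dₑ)
            (ω : (N.neighborSampling r n v θ).Ω),
            ((((N.neighborSampling r n v θ).tree ω).queries I : ℕ) : ℝ)
              ≤ C * (1 / ε ^ 2 * Real.log (1 / δ))) ∧
    -- lower bound: any algorithm on one-layer GraphSAGE-GCN
    (∀ (d₀ dₑ d₁ : ℕ) (σ : ℝ → ℝ) (K : ℝ≥0), 0 < d₀ → 0 < d₁ → LipschitzWith K σ →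
      (∃ a b : ℝ, σ a ≠ σ b) →
      (graphSageGCN σ d₀ dₑ d₁).LipschitzOnBounded ∧
      ∃ B₀ : ℝ, ∀ B : ℝ, B₀ ≤ B → ∀ δ : ℝ, 0 < δ → δ < 1 →
        ∃ c ε₀ : ℝ, 0 < c ∧ 0 < ε₀ ∧ ∀ ε : ℝ, 0 < ε → ε < ε₀ →
          ∀ A : (n : ℕ) → Fin n → EuclideanSpace ℝ (Fin d₁ × Fin d₀) →
              RandomizedAlgorithm (graphSageGCN σ d₀ dₑ d₁).loops n d₀ dₑ d₁,
            (graphSageGCN σ d₀ dₑ d₁).ApproximatedBy A B ε δ →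
            ∃ (n : ℕ) (v : Fin n) (θ : EuclideanSpace ℝ (Fin d₁ × Fin d₀))
              (I : GraphInput (graphSageGCN σ d₀ dₑ d₁).loops n d₀ dₑ),
              I.BoundedBy θ B ∧
              ENNReal.ofReal (c * (1 / ε ^ 2)) ≤ (A n v θ).expectedQueries I) := by
  refine ⟨fun d₀ dₑ dₕ d₁ P _ N hN B => N.exists_neighborSampling_approximatedBy hN B,
    fun d₀ dₑ d₁ σ K h₀ h₁ hσ hne => ⟨graphSageGCN_lipschitzOnBounded hσ d₀ dₑ d₁, ?_⟩⟩
  obtain ⟨a, b, hab, hne⟩ : ∃ a b : ℝ, a < b ∧ σ a ≠ σ b := by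
    obtain ⟨a, b, h⟩ := hne
    rcases lt_trichotomy a b with hlt | rfl | hgt
    · exact ⟨a, b, hlt, h⟩
    · exact absurd rfl h
    · exact ⟨b, a, hgt, h.symm⟩
  exact ⟨max 1 (max |2 * a - b| |2 * b - a|), fun B hB δ _ hδ =>
    graphSageGCN_query_lower_bound h₀ h₁ hσ hab hne hB hδ⟩
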